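/- A rooted tree over a finite set $V$ is a rooted tree whose vertex set is a subset of $V$. For an integer $d\ge 1$ and a rooted tree $T$ over $V$ of depth at most $d$, a set $B\subseteq V$ is a $(T,d)$-blocker set if every vertex of $T$ at depth exactly $d$ belongs to $B$ or has an ancestor in $T$ that belongs to $B$. For a collection $\mathcal{T}$ of such trees, $B$ is a $(\mathcal{T},d)$-blocker set if it is a $(T,d)$-blocker set for each $T\in\mathcal{T}$. Let $V=\{0,\dots,n-1\}$ with $n\ge 2$, let $1\le d\le n$ be an integer, and let $\mathcal{T}$ be a nonempty collection of rooted trees over $V$ of depth at most $d$, where $|\mathcal{T}|\le A n^{\alpha}$ for fixed constants $A,\alpha\in\mathbb{N}$. Suppose that each $T\in\mathcal{T}$ is given as a separate dynamic tree data structure, that is, a data structure holding a rooted forest on $V$ (initially $T$ together with the vertices of $V\setminus V(T)$ as isolated vertices) and supporting the following operations in $O(\log n)$ time each: $\mathtt{parent}(v)$ (return the parent of $v$, or nil if $v$ is a root); $\mathtt{link}(u,v)$ (for a root $u$ and a vertex $v$ of another tree, make $u$ a child of $v$); $\mathtt{cut}(v)$ (for a non-root $v$, remove the edge between $v$ and its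 parent); $\mathtt{depth}(v)$ (return the depth of the tree containing $v$). Suppose also that the root of each $T\in\mathcal{T}$ is known. Then there is a Las Vegas randomized algorithm (on a word RAM with words of $\Theta(\log n)$ bits, or longer, on which drawing a uniformly random element of $\{0,\dots,y-1\}$ takes constant time) which halts almost surely, whose output is always a $(\mathcal{T},d)$-blocker set $B$ of size $O\left(\frac{n}{d}\log n\right)$, and whose running time is $$O\left(|\mathcal{T}|\cdot\frac{n}{d}\cdot\log^2 n\right)$$ with high probability, i.e. for every constant $\beta$ the bound holds with probability at least $1-n^{-\beta}$. The algorithm and the constant in the size bound depend only on $A$ and $\alpha$; the constant in the running time may in addition depend on $\beta$ and on the constant in the $O(\log n)$ bound for the dynamic tree operations. -/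

import Mathlib

namespace DynTreeRAM

/-! ### Rooted forests given by parent pointers -/

section Forest

variable {V : Type}

/-- The vertex reached from `v` by following `k` parent pointers (`none` if one runs past a root). -/
def ancestor (p : V → Option V) (k : ℕ) (v : V) : Option V :=
  (fun o : Option V => o.bind p)^[k] (some v)

/-- `u` is `v` or a proper ancestor of `v`. -/
def IsAncestor (p : V → Option V) (u v : V) : Prop :=
  ∃ k, ancestor p k v = some u

/-- The depth of the vertex `v`: the number of edges between `v` and the root of its tree. -/
noncomputable def vertexDepth (p : V → Option V) (v : V) : ℕ :=
  sInf {k | ancestor p (k + 1) v = none}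

/-- `u` and `v` lie in the same tree of the forest. -/
def SameTree (p : V → Option V) (u v : V) : Prop :=
  ∃ r, IsAncestor p r u ∧ IsAncestor p r v

open Classical in
/-- The depth of the tree of the forest that contains `v`: the largest depth of its vertices. -/
noncomputable def treeDepth [Fintype V] (p : V → Option V) (v : V) : ℕ :=
  (Finset.univ.filter (fun u => SameTree p v u)).sup (vertexDepth p)

end Forest

/-- A rooted tree over `V`: its vertex set is a subset of `V`, every vertex of the tree other than
the root has a parent in the tree, and every vertex of the tree descends from the root.
Elements of `V` outside the tree carry no pointer, so `parent`, read on all of `V`, is the forest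
that consists of the tree and of isolated vertices. -/
structure OutTree (V : Type) where
  verts : Finset V
  root : V
  parent : V → Option V
  root_mem : root ∈ verts
  parent_root : parent root = none
  parent_outside : ∀ v, v ∉ verts → parent v = none
  parent_mem : ∀ v ∈ verts, v ≠ root → ∃ u ∈ verts, parent v = some u
  root_isAncestor : ∀ v ∈ verts, IsAncestor parent root v

/-- The tree has depth at most `d`. -/
def OutTree.DepthAtMost {V : Type} (T : OutTree V) (d : ℕ) : Prop :=
  ∀ v ∈ T.verts, vertexDepth T.parent v ≤ d

/-- `B` is a `(T, d)`-blocker set: every vertex of `T` of depth `d` is in `B` or has an ancestor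
in `B`. -/
def IsBlocker {V : Type} (T : OutTree V) (d : ℕ) (B : Finset V) : Prop :=
  ∀ v ∈ T.verts, vertexDepth T.parent v = d → ∃ u ∈ B, IsAncestor T.parent u v

/-- `B` is a blocker set for every member of a collection of trees. -/
def IsBlockerSet {V ι : Type} (T : ι → OutTree V) (d : ℕ) (B : Finset V) : Prop :=
  ∀ i, IsBlocker (T i) d B

/-! ### A randomized word RAM with access to dynamic trees

Programs work on variables and on finitely many arrays, whose cells hold words, i.e. numbers
below `2 ^ w`.  Every statement costs one unit of time; a call to a dynamic tree
structure costs `q` further units. -/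

/-- Arithmetic of the RAM. -/
inductive Op where
  | add | sub | mul | div | mod

/-- The value of an operation, reduced to a word (`sub` is truncated at `0`). -/
def Op.eval (w : ℕ) : Op → ℕ → ℕ → ℕ
  | .add, a, b => (a + b) % 2 ^ w
  | .sub, a, b => (a - b) % 2 ^ w
  | .mul, a, b => (a * b) % 2 ^ w
  | .div, a, b => (a / b) % 2 ^ w
  | .mod, a, b => (a % b) % 2 ^ w

/-- Tests on two variables. -/
inductive Test where
  | eq (x y : ℕ)
  | lt (x y : ℕ)

/-- The truth value of a test. -/
def Test.eval (var : ℕ → ℕ) : Test → Bool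
  | .eq x y => decide (var x = var y)
  | .lt x y => decide (var x < var y)

/-- Statements. Variables and arrays are named by numbers written in the program. In the last four
data-structure statements the variable `t` holds the index of a dynamic tree structure. -/
inductive Stmt where
  /-- do nothing -/
  | skip
  /-- fail: the run never halts -/
  | abort
  /-- `x := k` for a constant `k` of the program -/
  | const (x k : ℕ)
  /-- `x := y` -/
  | copy (x y : ℕ)
  /-- `x := y o z` -/
  | arith (o : Op) (x y z : ℕ)
  /-- `x := a[y]` -/
  | load (x a y : ℕ)
  /-- `a[y] := x` -/
  | store (a y x : ℕ)
  /-- `x :=` a fresh uniformly random element of `{0, …, y - 1}` -/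
  | rand (x y : ℕ)
  /-- `x := parent(v)` in structure `t`, where nil is represented by `n` -/
  | parent (x t v : ℕ)
  /-- `link(u, v)` in structure `t` -/
  | link (t u v : ℕ)
  /-- `cut(v)` in structure `t` -/
  | cut (t v : ℕ)
  /-- `x := depth(v)`, the depth of the tree containing `v`, in structure `t` -/
  | depth (x t v : ℕ)
  | seq (s₁ s₂ : Stmt)
  | ite (b : Test) (s₁ s₂ : Stmt)
  | loop (b : Test) (s : Stmt)

/-- A configuration: the statements still to be executed, the contents of the memory, the forests
over `{0, …, n - 1}` held by the `τ` dynamic tree structures, and the time spent so far. -/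
structure Config (n τ : ℕ) where
  code : List Stmt
  var : ℕ → ℕ
  arr : ℕ → ℕ → ℕ
  forest : Fin τ → Fin n → Option (Fin n)
  time : ℕ

/-- The run has halted. A failed run is not halted. -/
def Config.Halted {n τ : ℕ} (c : Config n τ) : Prop := c.code = []

/-- Assign the value `k` to the variable `x`. -/
def Config.assign {n τ : ℕ} (c : Config n τ) (x k : ℕ) : Config n τ :=
  { c with var := Function.update c.var x k }

/-- Write the value `k` into cell `i` of the array `a`. -/
def Config.write {n τ : ℕ} (c : Config n τ) (a i k : ℕ) : Config n τ :=
  { c with arr := Function.update c.arr a (Function.update (c.arr a) i k) }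

/-- Turn to the failing statement. -/
def Config.fail {n τ : ℕ} (c : Config n τ) : Config n τ :=
  { c with code := [Stmt.abort] }

/-- Replace the forest held by structure `t`. -/
def Config.setForest {n τ : ℕ} (c : Config n τ) (t : Fin τ) (p : Fin n → Option (Fin n)) :
    Config n τ :=
  { c with forest := Function.update c.forest t p }

/-- `parent(v)`; fails if there is no such structure or vertex. -/
def Config.callParent {n τ : ℕ} (c : Config n τ) (x t v : ℕ) : Config n τ :=
  if h : t < τ ∧ v < n then
    match c.forest ⟨t, h.1⟩ ⟨v, h.2⟩ with
    | none => c.assign x n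
    | some u => c.assign x u
  else c.fail

open Classical in
/-- `link(u, v)`; fails unless `u` is a root and `u`, `v` lie in different trees. -/
noncomputable def Config.callLink {n τ : ℕ} (c : Config n τ) (t u v : ℕ) : Config n τ :=
  if h : t < τ ∧ u < n ∧ v < n then
    let p := c.forest ⟨t, h.1⟩
    if p ⟨u, h.2.1⟩ = none ∧ ¬ SameTree p ⟨u, h.2.1⟩ ⟨v, h.2.2⟩ then
      c.setForest ⟨t, h.1⟩ (Function.update p ⟨u, h.2.1⟩ (some ⟨v, h.2.2⟩))
    else c.fail
  else c.fail

/-- `cut(v)`; fails if `v` is a root. -/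
def Config.callCut {n τ : ℕ} (c : Config n τ) (t v : ℕ) : Config n τ :=
  if h : t < τ ∧ v < n then
    let p := c.forest ⟨t, h.1⟩
    if p ⟨v, h.2⟩ = none then c.fail
    else c.setForest ⟨t, h.1⟩ (Function.update p ⟨v, h.2⟩ none)
  else c.fail

/-- `depth(v)`. -/
noncomputable def Config.callDepth {n τ : ℕ} (c : Config n τ) (x t v : ℕ) : Config n τ :=
  if h : t < τ ∧ v < n then
    c.assign x (treeDepth (c.forest ⟨t, h.1⟩) ⟨v, h.2⟩)
  else c.fail

/-- Execute the statement `s` in the configuration `c`, whose `code` holds what comes after `s`.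
`w` is the word length and `q` the time of a call to a dynamic tree structure. -/
noncomputable def exec {n τ : ℕ} (w q : ℕ) (s : Stmt) (c₀ : Config n τ) : PMF (Config n τ) :=
  let c : Config n τ := { c₀ with time := c₀.time + 1 }
  let c' : Config n τ := { c₀ with time := c₀.time + 1 + q }
  match s with
  | .skip => PMF.pure c
  | .abort => PMF.pure c.fail
  | .const x k => PMF.pure (c.assign x (k % 2 ^ w))
  | .copy x y => PMF.pure (c.assign x (c.var y))
  | .arith o x y z => PMF.pure (c.assign x (o.eval w (c.var y) (c.var z)))
  | .load x a y => PMF.pure (c.assign x (c.arr a (c.var y)))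
  | .store a y x => PMF.pure (c.write a (c.var y) (c.var x))
  | .rand x y =>
      match c.var y with
      | 0 => PMF.pure c.fail
      | k + 1 => (PMF.uniformOfFintype (Fin (k + 1))).map (fun i => c.assign x i)
  | .parent x t v => PMF.pure (c'.callParent x (c.var t) (c.var v))
  | .link t u v => PMF.pure (c'.callLink (c.var t) (c.var u) (c.var v))
  | .cut t v => PMF.pure (c'.callCut (c.var t) (c.var v))
  | .depth x t v => PMF.pure (c'.callDepth x (c.var t) (c.var v))
  | .seq s₁ s₂ => PMF.pure { c with code := s₁ :: s₂ :: c.code }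
  | .ite b s₁ s₂ => PMF.pure { c with code := (if b.eval c.var then s₁ else s₂) :: c.code }
  | .loop b s =>
      PMF.pure (if b.eval c.var then { c with code := s :: Stmt.loop b s :: c.code } else c)

/-- One step of the machine; halted configurations stay as they are. -/
noncomputable def step {n τ : ℕ} (w q : ℕ) (c : Config n τ) : PMF (Config n τ) :=
  match c.code with
  | [] => PMF.pure c
  | s :: rest => exec w q s { c with code := rest }

/-- The distribution of the configuration after `k` steps. -/
noncomputable def run {n τ : ℕ} (w q : ℕ) : ℕ → Config n τ → PMF (Config n τ)
  | 0, c => PMF.pure c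
  | k + 1, c => (step w q c).bind (run w q k)

/-- The initial configuration of program `P`: variables `0`, `1`, `2` hold `n`, `d` and the number
`τ` of trees, the `i`-th cell of array `0` holds the root of the `i`-th tree, the `i`-th dynamic
tree structure holds the `i`-th tree, everything else is `0`. -/
def initial {n τ : ℕ} (P : Stmt) (d : ℕ) (T : Fin τ → OutTree (Fin n)) : Config n τ where
  code := [P]
  var := fun x => if x = 0 then n else if x = 1 then d else if x = 2 then τ else 0
  arr := fun a i => if h : a = 0 ∧ i < τ then ((T ⟨i, h.2⟩).root : ℕ) else 0
  forest := fun i => (T i).parent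
  time := 0

/-- The output: the list of the first `k` cells of array `1`, where variable `3` holds `k`. -/
def Config.output {n τ : ℕ} (c : Config n τ) : List ℕ :=
  (List.range (c.var 3)).map (c.arr 1)

/-- The list `l` enumerates the set `B` of vertices. -/
def Enumerates {n : ℕ} (l : List ℕ) (B : Finset (Fin n)) : Prop :=
  l.toFinset = B.map Fin.valEmbedding

/-- The probability that program `P` halts. -/
noncomputable def haltProb {n τ : ℕ} (w q : ℕ) (P : Stmt) (d : ℕ)
    (T : Fin τ → OutTree (Fin n)) : ENNReal :=
  ⨆ k, (run w q k (initial P d T)).toOuterMeasure {c | c.Halted}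

/-- The probability that program `P` halts and that its running time is at most `t`. (A step takes
at least one unit of time, so a run of time at most `t` has at most `⌊t⌋` steps.) -/
noncomputable def haltProbWithin {n τ : ℕ} (w q : ℕ) (P : Stmt) (d : ℕ)
    (T : Fin τ → OutTree (Fin n)) (t : ℝ) : ENNReal :=
  (run w q ⌊t⌋₊ (initial P d T)).toOuterMeasure {c | c.Halted ∧ (c.time : ℝ) ≤ t}

/-- The inputs: `1 ≤ d ≤ n`, `n ≥ 2`, a nonempty collection of at most `A * n ^ α` rooted trees of
depth at most `d` over `{0, …, n - 1}`; words have at least `κ * log₂ n` bits. -/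
structure IsInput (A α κ n d τ w : ℕ) (T : Fin τ → OutTree (Fin n)) : Prop where
  two_le : 2 ≤ n
  d_pos : 1 ≤ d
  d_le : d ≤ n
  nonempty : 1 ≤ τ
  card_le : τ ≤ A * n ^ α
  word : n ^ κ ≤ 2 ^ w
  depth : ∀ i, (T i).DepthAtMost d

end DynTreeRAM

/-! The algorithm draws s = O((n/d) log n) vertices uniformly with repetition, lets the dynamic
trees decide whether the sample blocks every tree, and starts afresh until it does.

A vertex of depth d has at least d ancestors other than the root, itself included
(`OutTree.le_card_ancestors`), so a random vertex misses all of them with probability at most 1 -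
d/n. Averaging over one draw at a time (`sum_card_unhit_le`, `failProb_sample_le`), the expected
number of pairs of a tree and an unhit vertex of depth d is at most τ n (1 - d/n)^s, which is at
most 1/n for the chosen s (`missProb_pow_le`). A rejected sample leaves at least one such pair, so a
round fails with probability at most 1/n.

To test a tree, all sampled vertices are cut off. What stays attached to the root has depth below d
exactly if every vertex of depth d has a sampled ancestor other than the root
(`OutTree.treeDepth_cutForest_lt_iff`). A root cannot be cut, hence `Hit` ignores it; acceptance is
thus stronger than blocking, and the probability estimate still applies. The cuts are undone in
reverse order.

Apart from the draws the machine is deterministic (`Det`), and r rounds fail with probability at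
most n^(-r) (`failProb_rounds_le`). Taking r = ⌈β⌉ gives the time bound. Letting r tend to infinity
gives almost sure halting, and also correctness of every reachable halted configuration. -/

namespace DynTreeRAM

open scoped ENNReal

/-! ### Rooted forests -/

section Forest

variable {V : Type} {p f : V → Option V} {u v x : V}

theorem ancestor_zero (p : V → Option V) (v : V) : ancestor p 0 v = some v := rfl

theorem ancestor_succ (p : V → Option V) (k : ℕ) (v : V) :
    ancestor p (k + 1) v = (ancestor p k v).bind p := by
  simp only [ancestor, Function.iterate_succ_apply']

theorem ancestor_add (p : V → Option V) (j k : ℕ) (v : V) :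
    ancestor p (j + k) v = (ancestor p j v).bind (ancestor p k) := by
  induction k with
  | zero => cases h : ancestor p j v <;> simp [ancestor_zero]
  | succ k ih =>
    rw [← add_assoc, ancestor_succ, ih, Option.bind_assoc]
    simp only [ancestor_succ]

theorem ancestor_none_mono {j k : ℕ} (hjk : j ≤ k) (h : ancestor p j v = none) :
    ancestor p k v = none := by
  obtain ⟨m, rfl⟩ := Nat.exists_eq_add_of_le hjk
  rw [ancestor_add, h]; rfl

theorem exists_ancestor_of_le {j k : ℕ} (hjk : j ≤ k) (h : ancestor p k v = some u) :
    ∃ y, ancestor p j v = some y := by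
  cases hj : ancestor p j v with
  | some y => exact ⟨y, rfl⟩
  | none => rw [ancestor_none_mono hjk hj] at h; cases h

/-- The pointer path stops one step after the root and, by `ancestor_none_mono`, no earlier. So any
path to a root measures the depth that `vertexDepth` defines by an infimum. -/
theorem vertexDepth_eq_of_ancestor_root {r : V} {k : ℕ} (hr : p r = none)
    (h : ancestor p k v = some r) : vertexDepth p v = k := by
  have hk : ancestor p (k + 1) v = none := by rw [ancestor_succ, h]; exact hr
  apply le_antisymm (Nat.sInf_le hk)
  refine le_csInf ⟨k, hk⟩ fun m hm => ?_
  by_contra! hlt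
  rw [ancestor_none_mono (Nat.succ_le_of_lt hlt) hm] at h
  cases h

/-- `f` arises from `p` by deleting edges. -/
def Subforest (f p : V → Option V) : Prop := ∀ u, f u = none ∨ f u = p u

theorem Subforest.apply_eq_some (hf : Subforest f p) (h : f u = some x) : p u = some x := by
  rcases hf u with h' | h' <;> simp_all

theorem Subforest.ancestor_eq_some (hf : Subforest f p) {k : ℕ} (h : ancestor f k v = some u) :
    ancestor p k v = some u := by
  induction k generalizing u with
  | zero => exact h
  | succ k ih =>
    rw [ancestor_succ] at h ⊢
    obtain ⟨y, hy, hyu⟩ := Option.bind_eq_some_iff.1 h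
    rw [ih hy]
    exact hf.apply_eq_some hyu

/-- A root is its own only ancestor, so the common ancestor of r and v must be r. -/
theorem isAncestor_of_sameTree_root {r : V} (hr : f r = none) (h : SameTree f r v) :
    IsAncestor f r v := by
  obtain ⟨y, ⟨k, hk⟩, hv⟩ := h
  cases k with
  | zero => rw [ancestor_zero] at hk; cases hk; exact hv
  | succ k =>
    rw [add_comm, ancestor_add] at hk
    simp [ancestor_succ, ancestor_zero, hr] at hk

theorem OutTree.mem_of_parent (T : OutTree V) (h : T.parent u = some x) : u ∈ T.verts := by
  by_contra hu
  rw [T.parent_outside u hu] at h; cases h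

/-- Trees are acyclic: a cycle through u could be followed forever, whereas the pointer path from u
ends at the root. -/
theorem OutTree.ancestor_self_eq_zero (T : OutTree V) (hu : u ∈ T.verts) {k : ℕ}
    (h : ancestor T.parent k u = some u) : k = 0 := by
  by_contra hk
  obtain ⟨m, hm⟩ := T.root_isAncestor u hu
  have hcyc : ∀ j, ancestor T.parent (k * j) u = some u := fun j => by
    induction j with
    | zero => rfl
    | succ j ih => rw [Nat.mul_succ, ancestor_add, ih]; exact h
  have h1 : ancestor T.parent (m + 1) u = none := by
    rw [ancestor_succ, hm]; exact T.parent_root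
  have h2 := ancestor_none_mono (p := T.parent) (v := u) (k := k * (m + 1))
    (Nat.le_mul_of_pos_left _ (Nat.pos_of_ne_zero hk)) h1
  rw [hcyc] at h2; cases h2

/-- In a forest obtained from a tree by cutting, a cut edge may be linked again. -/
theorem OutTree.not_sameTree (T : OutTree V) (hf : Subforest f T.parent) (hu : f u = none)
    (hx : T.parent u = some x) : ¬ SameTree f u x := by
  intro h
  obtain ⟨k, hk⟩ := isAncestor_of_sameTree_root hu h
  -- If u were an ancestor of its own parent x, prefixing the edge from u to x would close a cycle
  -- of length 1 + k.
  have := T.ancestor_self_eq_zero (T.mem_of_parent hx) (k := 1 + k)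
    (by rw [ancestor_add]; simpa [ancestor_succ, ancestor_zero, hx] using hf.ancestor_eq_some hk)
  omega

theorem OutTree.mem_of_isAncestor_root (T : OutTree V) (h : IsAncestor T.parent T.root v) :
    v ∈ T.verts := by
  obtain ⟨k, hk⟩ := h
  cases k with
  | zero => rw [ancestor_zero] at hk; cases hk; exact T.root_mem
  | succ k =>
    rw [add_comm, ancestor_add] at hk
    cases hv : T.parent v with
    | none => simp [ancestor_succ, ancestor_zero, hv] at hk
    | some x => exact T.mem_of_parent hv

theorem OutTree.ancestor_vertexDepth (T : OutTree V) (hv : v ∈ T.verts) :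
    ancestor T.parent (vertexDepth T.parent v) v = some T.root := by
  obtain ⟨k, hk⟩ := T.root_isAncestor v hv
  rwa [vertexDepth_eq_of_ancestor_root T.parent_root hk]

/-- `v` has an ancestor, other than the root, among the first `j` terms of `b`. -/
def Hit (T : OutTree V) (b : ℕ → V) (j : ℕ) (v : V) : Prop :=
  ∃ l < j, b l ≠ T.root ∧ IsAncestor T.parent (b l) v

open Classical in
/-- The forest `p` after the first `j` terms of `b` have been cut from their parents. -/
noncomputable def cutForest (p : V → Option V) (b : ℕ → V) (j : ℕ) : V → Option V :=
  fun u => if ∃ l < j, b l = u then none else p u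

variable {b : ℕ → V} {j : ℕ}

/-! ### Cutting a sequence of vertices from a tree -/

theorem cutForest_zero : cutForest p b 0 = p := by
  funext u; simp [cutForest]

theorem cutForest_subforest : Subforest (cutForest p b j) p := fun u => by
  unfold cutForest; split_ifs <;> simp

theorem cutForest_eq_none {l : ℕ} (hl : l < j) : cutForest p b j (b l) = none :=
  if_pos ⟨l, hl, rfl⟩

theorem cutForest_succ [DecidableEq V] :
    cutForest p b (j + 1) = Function.update (cutForest p b j) (b j) none := by
  funext u
  by_cases hu : u = b j
  · subst hu; simp [cutForest_eq_none]
  · rw [Function.update_of_ne hu]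
    have : (∃ l < j + 1, b l = u) ↔ ∃ l < j, b l = u := by
      constructor
      · rintro ⟨l, hl, rfl⟩
        refine ⟨l, ?_, rfl⟩
        rcases Nat.lt_succ_iff_lt_or_eq.1 hl with h | rfl
        · exact h
        · exact absurd rfl hu
      · rintro ⟨l, hl, rfl⟩; exact ⟨l, by omega, rfl⟩
    unfold cutForest
    by_cases h : ∃ l < j, b l = u
    · rw [if_pos h, if_pos (this.2 h)]
    · rw [if_neg h, if_neg (mt this.1 h)]

/-- This covers a sample that is already a root: the root of the tree, a vertex outside the tree, or
a repetition. -/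
theorem cutForest_succ_of_none (h : cutForest p b j (b j) = none) :
    cutForest p b (j + 1) = cutForest p b j := by
  classical
  rw [cutForest_succ, Function.update_eq_self_iff, h]

theorem cutForest_of_succ [DecidableEq V] (h : cutForest p b j (b j) = some x) :
    Function.update (cutForest p b (j + 1)) (b j) (some x) = cutForest p b j := by
  rw [cutForest_succ, Function.update_idem, Function.update_eq_self_iff, h]

theorem OutTree.cutForest_root (T : OutTree V) : cutForest T.parent b j T.root = none := by
  unfold cutForest; split_ifs
  · rfl
  · exact T.parent_root

/-- A cut changes the path from v only at a cut vertex that still has a parent. At distance less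
than the depth of v the path has not reached the root, so such a cut would hit v. -/
theorem OutTree.ancestor_cutForest (T : OutTree V) (hv : v ∈ T.verts) (h : ¬ Hit T b j v) {k : ℕ}
    (hk : k ≤ vertexDepth T.parent v) :
    ancestor (cutForest T.parent b j) k v = ancestor T.parent k v := by
  induction k with
  | zero => rfl
  | succ k ih =>
    rw [ancestor_succ, ancestor_succ, ih (by omega)]
    obtain ⟨y, hy⟩ := exists_ancestor_of_le (by omega) (T.ancestor_vertexDepth hv)
      (j := k)
    rw [hy, Option.bind_some, Option.bind_some]
    refine if_neg ?_
    rintro ⟨l, hl, rfl⟩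
    refine h ⟨l, hl, ?_, k, hy⟩
    intro hr
    rw [hr] at hy
    have := vertexDepth_eq_of_ancestor_root T.parent_root hy
    omega

/-- The depth query after cutting decides whether every vertex of depth `d` is hit. -/
theorem OutTree.treeDepth_cutForest_lt_iff [Fintype V] (T : OutTree V) {d : ℕ} (hd : 1 ≤ d)
    (hT : T.DepthAtMost d) :
    treeDepth (cutForest T.parent b j) T.root < d ↔
      ∀ v ∈ T.verts, vertexDepth T.parent v = d → Hit T b j v := by
  classical
  unfold treeDepth
  rw [Finset.sup_lt_iff (show ⊥ < d from hd)]
  simp only [Finset.mem_filter, Finset.mem_univ, true_and]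
  constructor
  -- An unhit vertex of depth d keeps its whole path to the root, so the remaining tree still has
  -- depth at least d.
  · intro H v hv hvd
    by_contra hh
    have ha : ancestor (cutForest T.parent b j) d v = some T.root := by
      rw [T.ancestor_cutForest hv hh hvd.ge, ← hvd, T.ancestor_vertexDepth hv]
    have := H v ⟨T.root, ⟨0, rfl⟩, d, ha⟩
    rw [vertexDepth_eq_of_ancestor_root T.cutForest_root ha] at this
    exact lt_irrefl _ this
  -- A vertex still attached to the root has kept its depth k, which is at most d. If k = d, a cut
  -- ancestor at some distance m < k would end its path too early.
  · intro H v hv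
    obtain ⟨k, hk⟩ := isAncestor_of_sameTree_root T.cutForest_root hv
    rw [vertexDepth_eq_of_ancestor_root T.cutForest_root hk]
    have hk' := cutForest_subforest.ancestor_eq_some hk
    have hmem := T.mem_of_isAncestor_root ⟨k, hk'⟩
    have hdep := vertexDepth_eq_of_ancestor_root T.parent_root hk'
    refine lt_of_le_of_ne (hdep ▸ hT v hmem) ?_
    rintro rfl
    obtain ⟨l, hl, hne, m, hm⟩ := H v hmem hdep
    -- At distance k from v sits the root, which b l is not, and beyond k there is nothing.
    have hmk : m < k := by
      by_contra! hkm
      rcases hkm.eq_or_lt with rfl | hlt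
      · rw [hm] at hk'; exact hne (Option.some.inj hk')
      · have : ancestor T.parent (k + 1) v = none := by
          rw [ancestor_succ, hk']; exact T.parent_root
        rw [ancestor_none_mono hlt this] at hm; cases hm
    obtain ⟨y, hy⟩ := exists_ancestor_of_le hmk.le hk
    have hyb : y = b l := by
      have := cutForest_subforest.ancestor_eq_some hy
      rw [hm] at this; exact (Option.some.inj this).symm
    subst hyb
    have : ancestor (cutForest T.parent b j) (m + 1) v = none := by
      rw [ancestor_succ, hy]; exact cutForest_eq_none hl
    rw [ancestor_none_mono hmk this] at hk
    cases hk

open Classical in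
/-- A vertex of depth `d` has at least `d` ancestors other than the root. -/
theorem OutTree.le_card_ancestors [Fintype V] (T : OutTree V) (hv : v ∈ T.verts) :
    vertexDepth T.parent v ≤
      (Finset.univ.filter (fun u => u ≠ T.root ∧ IsAncestor T.parent u v)).card := by
  set d := vertexDepth T.parent v with hd
  have key : ∀ k : Fin d, ∃ y, ancestor T.parent k v = some y := fun k =>
    exists_ancestor_of_le k.2.le (T.ancestor_vertexDepth hv)
  choose g hg using key
  have hinj : Function.Injective g := by
    -- A coincidence of two terms of the path would be a cycle of length l - k > 0.
    have aux : ∀ k l : Fin d, k < l → g k ≠ g l := by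
      intro k l hkl h
      have h1 : ancestor T.parent (l - k : ℕ) (g k) = some (g k) := by
        have := hg l
        rw [show (l : ℕ) = k + (l - k) by omega, ancestor_add, hg k] at this
        rw [h] at this ⊢
        exact this
      have hroot : IsAncestor T.parent T.root (g k) := by
        refine ⟨d - k, ?_⟩
        have := T.ancestor_vertexDepth hv
        rw [← hd, show d = k + (d - k) by omega, ancestor_add, hg k] at this
        exact this
      have := T.ancestor_self_eq_zero (T.mem_of_isAncestor_root hroot) h1
      omega
    intro k l h
    rcases lt_trichotomy k l with hlt | heq | hlt
    · exact absurd h (aux _ _ hlt)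
    · exact heq
    · exact absurd h.symm (aux _ _ hlt)
  have : d = (Finset.univ.image g).card := by
    rw [Finset.card_image_of_injective _ hinj]; simp
  rw [this]
  apply Finset.card_le_card
  intro u hu
  obtain ⟨k, -, rfl⟩ := Finset.mem_image.1 hu
  simp only [Finset.mem_filter, Finset.mem_univ, true_and]
  -- The root is reached only at distance d, and k < d.
  refine ⟨fun h => ?_, k, hg k⟩
  have h1 := hg k
  rw [h] at h1
  have := vertexDepth_eq_of_ancestor_root T.parent_root h1
  have := k.2
  omega

end Forest

/-! ### Deterministic runs of the machine -/

section Det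

variable {n τ : ℕ} {w q N N₁ N₂ : ℕ} {c : Config n τ} {Q R : Config n τ → Prop}

theorem run_add (w q a k : ℕ) (c : Config n τ) :
    run w q (a + k) c = (run w q a c).bind (run w q k) := by
  induction a generalizing c with
  | zero => simp [run]
  | succ a ih =>
    rw [show a + 1 + k = (a + k) + 1 by omega]
    simp only [run, PMF.bind_bind]
    congr 1; funext c'; exact ih c'

theorem run_one (w q : ℕ) (c : Config n τ) : run w q 1 c = step w q c := by
  simp [run]

/-- Executing `s` from `c` takes at most `N` steps, is deterministic and ends in a configuration
that satisfies `Q`. -/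
def Det (w q N : ℕ) (s : Stmt) (c : Config n τ) (Q : Config n τ → Prop) : Prop :=
  ∃ k ≤ N, ∃ c', Q c' ∧
    ∀ l, run w q k { c with code := s :: l } = PMF.pure { c' with code := l }

theorem Det.mono {s : Stmt} (h : Det w q N₁ s c Q) (hN : N₁ ≤ N) (hQ : ∀ c', Q c' → R c') :
    Det w q N s c R := by
  obtain ⟨k, hk, c', h1, h2⟩ := h
  exact ⟨k, hk.trans hN, c', hQ _ h1, h2⟩

theorem det_of_exec {s : Stmt} {c' : Config n τ}
    (h : ∀ l, exec w q s { c with code := l } = PMF.pure { c' with code := l }) (hQ : Q c') :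
    Det w q 1 s c Q :=
  ⟨1, le_rfl, c', hQ, fun l => by rw [run_one]; exact h l⟩

theorem det_skip (h : Q { c with time := c.time + 1 }) : Det w q 1 .skip c Q :=
  det_of_exec (fun _ => rfl) h

theorem det_const {x k : ℕ} (h : Q (Config.assign { c with time := c.time + 1 } x (k % 2 ^ w))) :
    Det w q 1 (.const x k) c Q :=
  det_of_exec (fun _ => rfl) h

theorem det_copy {x y : ℕ} (h : Q (Config.assign { c with time := c.time + 1 } x (c.var y))) :
    Det w q 1 (.copy x y) c Q :=
  det_of_exec (fun _ => rfl) h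

theorem det_arith {o : Op} {x y z : ℕ}
    (h : Q (Config.assign { c with time := c.time + 1 } x (o.eval w (c.var y) (c.var z)))) :
    Det w q 1 (.arith o x y z) c Q :=
  det_of_exec (fun _ => rfl) h

theorem det_load {x a y : ℕ}
    (h : Q (Config.assign { c with time := c.time + 1 } x (c.arr a (c.var y)))) :
    Det w q 1 (.load x a y) c Q :=
  det_of_exec (fun _ => rfl) h

theorem det_store {a y x : ℕ}
    (h : Q (Config.write { c with time := c.time + 1 } a (c.var y) (c.var x))) :
    Det w q 1 (.store a y x) c Q :=
  det_of_exec (fun _ => rfl) h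

/-- The number by which the answer to a parent query is represented. -/
def parentCode : Option (Fin n) → ℕ
  | none => n
  | some u => u

theorem parentCode_eq_iff {o : Option (Fin n)} : parentCode o = n ↔ o = none := by
  cases o with
  | none => simp [parentCode]
  | some u => simpa [parentCode] using u.2.ne

theorem det_parent {x t v : ℕ} (t' : Fin τ) (v' : Fin n) (ht : c.var t = t') (hv : c.var v = v')
    (h : Q (Config.assign { c with time := c.time + 1 + q } x (parentCode (c.forest t' v')))) :
    Det w q 1 (.parent x t v) c Q := by
  refine det_of_exec (c' := Config.assign { c with time := c.time + 1 + q } x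
    (parentCode (c.forest t' v'))) (fun l => ?_) h
  simp only [exec, Config.callParent, ht, hv]
  rw [dif_pos ⟨t'.2, v'.2⟩]
  simp only [Fin.eta]
  cases c.forest t' v' <;> rfl

theorem det_link {t u v : ℕ} (t' : Fin τ) (u' v' : Fin n) (ht : c.var t = t') (hu : c.var u = u')
    (hv : c.var v = v') (hnone : c.forest t' u' = none) (hst : ¬ SameTree (c.forest t') u' v')
    (h : Q (Config.setForest { c with time := c.time + 1 + q } t'
      (Function.update (c.forest t') u' (some v')))) :
    Det w q 1 (.link t u v) c Q := by
  refine det_of_exec (c' := Config.setForest { c with time := c.time + 1 + q } t'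
      (Function.update (c.forest t') u' (some v'))) (fun l => ?_) h
  obtain ⟨_, h1⟩ := t'
  obtain ⟨_, h2⟩ := u'
  obtain ⟨_, h3⟩ := v'
  dsimp only at ht hu hv
  subst ht hu hv
  simp only [exec, Config.callLink]
  rw [dif_pos ⟨h1, h2, h3⟩, if_pos ⟨hnone, hst⟩]
  rfl

theorem det_cut {t v : ℕ} (t' : Fin τ) (v' : Fin n) (ht : c.var t = t') (hv : c.var v = v')
    (hsome : c.forest t' v' ≠ none)
    (h : Q (Config.setForest { c with time := c.time + 1 + q } t'
      (Function.update (c.forest t') v' none))) :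
    Det w q 1 (.cut t v) c Q := by
  refine det_of_exec (c' := Config.setForest { c with time := c.time + 1 + q } t'
      (Function.update (c.forest t') v' none)) (fun l => ?_) h
  simp only [exec, Config.callCut, ht, hv]
  rw [dif_pos ⟨t'.2, v'.2⟩]
  simp only [Fin.eta]
  rw [if_neg hsome]
  rfl

theorem det_depth {x t v : ℕ} (t' : Fin τ) (v' : Fin n) (ht : c.var t = t') (hv : c.var v = v')
    (h : Q (Config.assign { c with time := c.time + 1 + q } x (treeDepth (c.forest t') v'))) :
    Det w q 1 (.depth x t v) c Q := by
  refine det_of_exec (c' := Config.assign { c with time := c.time + 1 + q } x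
    (treeDepth (c.forest t') v')) (fun l => ?_) h
  simp only [exec, Config.callDepth, ht, hv]
  rw [dif_pos ⟨t'.2, v'.2⟩]
  rfl

/-- The extra unit is the step that unfolds the `seq` statement. With `R` of the form `_ = c'`, the
intermediate configuration is passed on exactly. -/
theorem det_seq {s₁ s₂ : Stmt} (h₁ : Det w q N₁ s₁ { c with time := c.time + 1 } R)
    (h₂ : ∀ c', R c' → Det w q N₂ s₂ c' Q) : Det w q (N₁ + N₂ + 1) (.seq s₁ s₂) c Q := by
  obtain ⟨k₁, hk₁, c₁, hR, r₁⟩ := h₁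
  obtain ⟨k₂, hk₂, c₂, hQ, r₂⟩ := h₂ c₁ hR
  refine ⟨1 + (k₁ + k₂), by omega, c₂, hQ, fun l => ?_⟩
  rw [run_add, run_one]
  change (PMF.pure _).bind _ = _
  rw [PMF.pure_bind, run_add]
  refine Eq.trans (congrArg (fun z => PMF.bind z _) (r₁ (s₂ :: l))) ?_
  rw [PMF.pure_bind, r₂]

theorem det_ite {b : Test} {s₁ s₂ : Stmt}
    (h₁ : b.eval c.var = true → Det w q N s₁ { c with time := c.time + 1 } Q)
    (h₂ : b.eval c.var = false → Det w q N s₂ { c with time := c.time + 1 } Q) :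
    Det w q (N + 1) (.ite b s₁ s₂) c Q := by
  have key : Det w q N (if b.eval c.var then s₁ else s₂) { c with time := c.time + 1 } Q := by
    cases hb : b.eval c.var
    · exact h₂ hb
    · exact h₁ hb
  obtain ⟨k, hk, c', hQ, r⟩ := key
  refine ⟨1 + k, by omega, c', hQ, fun l => ?_⟩
  rw [run_add, run_one]
  change (PMF.pure _).bind _ = _
  rw [PMF.pure_bind]
  exact r l

/-- A loop whose invariant `I` counts the remaining iterations. -/
theorem det_loop {b : Test} {s : Stmt} (I : ℕ → Config n τ → Prop)
    (h : ∀ m c, I (m + 1) c → b.eval c.var = true ∧ Det w q N s { c with time := c.time + 1 } (I m))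
    (h₀ : ∀ c, I 0 c → b.eval c.var = false ∧ Q { c with time := c.time + 1 })
    (m : ℕ) (hc : I m c) : Det w q (m * (N + 1) + 1) (.loop b s) c Q := by
  induction m generalizing c with
  | zero =>
    refine ⟨1, by omega, _, (h₀ c hc).2, fun l => ?_⟩
    rw [run_one]
    change PMF.pure (if b.eval c.var then _ else _) = _
    rw [(h₀ c hc).1]
    rfl
  | succ m ih =>
    obtain ⟨hb, k₁, hk₁, c₁, hI, r₁⟩ := h m c hc
    obtain ⟨k₂, hk₂, c₂, hQ, r₂⟩ := ih hI
    refine ⟨1 + (k₁ + k₂), by rw [Nat.succ_mul]; omega, c₂, hQ, fun l => ?_⟩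
    rw [run_add, run_one]
    change (PMF.pure (if b.eval c.var then _ else _)).bind _ = _
    rw [hb, if_pos rfl, PMF.pure_bind, run_add]
    refine Eq.trans (congrArg (fun z => PMF.bind z _) (r₁ (Stmt.loop b s :: l))) ?_
    rw [PMF.pure_bind, r₂]

end Det

/-! ### The verification phase -/

/-- Cut the sampled vertex with index `var 8` in structure `var 7` and remember its parent. -/
def cutBody : Stmt :=
  .seq (.load 9 1 8) <| .seq (.parent 10 7 9) <| .seq (.store 2 8 10) <|
    .seq (.ite (.eq 10 0) .skip (.cut 7 9)) (.arith .add 8 8 4)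

/-- Undo the cut with index `var 8 - 1`. -/
def linkBody : Stmt :=
  .seq (.arith .sub 8 8 4) <| .seq (.load 9 1 8) <| .seq (.load 10 2 8) <|
    .ite (.eq 10 0) .skip (.link 7 9 10)

/-- Clear the flag `var 5` unless the sample is accepted for structure `var 7`. -/
def treeBody : Stmt :=
  .seq (.load 11 0 7) <| .seq (.const 8 0) <| .seq (.loop (.lt 8 3) cutBody) <|
    .seq (.depth 17 7 11) <| .seq (.ite (.lt 17 1) .skip (.copy 5 6)) <|
    .seq (.loop (.lt 6 8) linkBody) (.arith .add 7 7 4)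

/-- Set the flag `var 5` to `1` or `0` according to whether the sample is accepted. -/
def verify : Stmt :=
  .seq (.const 5 1) <| .seq (.const 7 0) <| .loop (.lt 7 2) treeBody

section Verify

variable {n τ : ℕ} {w q d s j : ℕ} {T : Fin τ → OutTree (Fin n)} {b : ℕ → Fin n} {t : Fin τ}
  {c : Config n τ} {f : ℕ}

/-- The part of the memory that is constant during the verification: the input, the size `s` of
the sample, the constants `0` and `1`, and the first `m` samples. -/
structure Frame (T : Fin τ → OutTree (Fin n)) (d s m : ℕ) (b : ℕ → Fin n) (c : Config n τ) :
    Prop where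
  var0 : c.var 0 = n
  var1 : c.var 1 = d
  var2 : c.var 2 = τ
  var3 : c.var 3 = s
  var4 : c.var 4 = 1
  var6 : c.var 6 = 0
  arr0 : ∀ i : Fin τ, c.arr 0 i = (T i).root
  arr1 : ∀ l < m, c.arr 1 l = b l

/-- The first `j` sampled vertices have been cut in structure `t`, and their parents stored. -/
structure CutState (T : Fin τ → OutTree (Fin n)) (d s : ℕ) (b : ℕ → Fin n) (t : Fin τ) (f j : ℕ)
    (c : Config n τ) : Prop where
  frame : Frame T d s s b c
  var7 : c.var 7 = t
  var11 : c.var 11 = (T t).root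
  var5 : c.var 5 = f
  var8 : c.var 8 = j
  le : j ≤ s
  forest : c.forest = Function.update (fun i => (T i).parent) t (cutForest (T t).parent b j)
  arr2 : ∀ l < j, c.arr 2 l = parentCode (cutForest (T t).parent b l (b l))

theorem CutState.setTime (h : CutState T d s b t f j c) (m : ℕ) :
    CutState T d s b t f j { c with time := m } :=
  ⟨⟨h.1.1, h.1.2, h.1.3, h.1.4, h.1.5, h.1.6, h.1.7, h.1.8⟩, h.2, h.3, h.4, h.5, h.6, h.7, h.8⟩

theorem CutState.forest_self (h : CutState T d s b t f j c) :
    c.forest t = cutForest (T t).parent b j := by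
  rw [h.forest, Function.update_self]

/-- Cell j of array 2 records the parent at the moment of the cut. The machine fails on cutting a
root, so nothing is cut when the answer is nil; a repeated sample therefore records nil, and undoing
will skip it too. -/
theorem det_cutBody (h : CutState T d s b t f j c) (hj : j < s) (hs : s < 2 ^ w) :
    Det w q 10 cutBody c (CutState T d s b t f (j + 1)) := by
  have hfs := h.forest_self
  obtain ⟨⟨v0, v1, v2, v3, v4, v6, a0, a1⟩, v7, v11, v5, v8, -, hf, a2⟩ := h
  have hadd : (j + 1) % 2 ^ w = j + 1 := Nat.mod_eq_of_lt (by omega)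
  refine det_seq (N₁ := 1) (N₂ := 8) (R := fun c' => _ = c') (det_load rfl) ?_
  rintro _ rfl
  refine det_seq (N₁ := 1) (N₂ := 6) (R := fun c' => _ = c')
    (det_parent t (b j) (by simp [Config.assign, v7]) (by simp [Config.assign, v8, a1 j hj]) rfl) ?_
  rintro _ rfl
  refine det_seq (N₁ := 1) (N₂ := 4) (R := fun c' => _ = c') (det_store rfl) ?_
  rintro _ rfl
  refine det_seq (N₁ := 2) (N₂ := 1)
    (R := fun c' => Frame T d s s b c' ∧ c'.var 7 = t ∧ c'.var 11 = (T t).root ∧ c'.var 5 = f ∧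
      c'.var 8 = j ∧ c'.forest = Function.update (fun i => (T i).parent) t
        (cutForest (T t).parent b (j + 1)) ∧
      ∀ l < j + 1, c'.arr 2 l = parentCode (cutForest (T t).parent b l (b l))) ?_ ?_
  · have hfr : Frame T d s s b (Config.write (Config.assign (Config.assign c 9 (c.arr 1 (c.var 8)))
        10 (parentCode (c.forest t (b j)))) 2 j (parentCode (c.forest t (b j)))) := by
      constructor <;> simp_all [Config.assign, Config.write]
    have ha2 : ∀ l < j + 1, Function.update (c.arr 2) j (parentCode (c.forest t (b j))) l =
        parentCode (cutForest (T t).parent b l (b l)) := by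
      intro l hl
      by_cases hlj : l = j
      · subst hlj; simp [hfs]
      · rw [Function.update_of_ne hlj]; exact a2 l (by omega)
    refine det_ite (N := 1) (fun hb => ?_) (fun hb => ?_)
    · simp [Test.eval, Config.assign, Config.write, v0, parentCode_eq_iff, hfs] at hb
      refine det_skip ⟨?_, ?_, ?_, ?_, ?_, ?_, ?_⟩
      · constructor <;> simp_all [Config.assign, Config.write]
      · simp [Config.assign, Config.write, v7]
      · simp [Config.assign, Config.write, v11]
      · simp [Config.assign, Config.write, v5]
      · simp [Config.assign, Config.write, v8]
      · simp [Config.assign, Config.write, hf, cutForest_succ_of_none hb]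
      · simpa [Config.assign, Config.write, v8] using ha2
    · simp [Test.eval, Config.assign, Config.write, v0, parentCode_eq_iff, hfs] at hb
      refine det_cut t (b j) (by simp [Config.assign, Config.write, v7])
        (by simp [Config.assign, Config.write, v8, a1 j hj])
        (by simpa [Config.assign, Config.write, hfs] using hb) ⟨?_, ?_, ?_, ?_, ?_, ?_, ?_⟩
      · constructor <;> simp_all [Config.assign, Config.write, Config.setForest]
      · simp [Config.assign, Config.write, Config.setForest, v7]
      · simp [Config.assign, Config.write, Config.setForest, v11]
      · simp [Config.assign, Config.write, Config.setForest, v5]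
      · simp [Config.assign, Config.write, Config.setForest, v8]
      · simp [Config.assign, Config.write, Config.setForest, hf, cutForest_succ]
      · simpa [Config.assign, Config.write, Config.setForest, v8] using ha2
  · rintro c' ⟨⟨v0, v1, v2, v3, v4, v6, a0, a1⟩, v7, v11, v5, v8, hf, a2⟩
    refine det_arith ⟨⟨?_, ?_, ?_, ?_, ?_, ?_, ?_, ?_⟩, ?_, ?_, ?_, ?_, hj, ?_, ?_⟩ <;>
      simp_all [Config.assign, Op.eval]

/-- Undoing in reverse order restores the forest as it was before cut j. The link is legal because
it reinserts an edge of the original tree into a subforest of it (`OutTree.not_sameTree`). -/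
theorem det_linkBody (h : CutState T d s b t f (j + 1) c) (hs : s < 2 ^ w) :
    Det w q 8 linkBody c (CutState T d s b t f j) := by
  have hfs := h.forest_self
  obtain ⟨⟨v0, v1, v2, v3, v4, v6, a0, a1⟩, v7, v11, v5, v8, hle, hf, a2⟩ := h
  have hsub : (j + 1 - 1) % 2 ^ w = j := Nat.mod_eq_of_lt (by omega)
  have a1j := a1 j hle
  have a2j := a2 j (by omega)
  have a2' : ∀ l < j, c.arr 2 l = parentCode (cutForest (T t).parent b l (b l)) :=
    fun l hl => a2 l (by omega)
  have hle' : j ≤ s := by omega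
  refine det_seq (N₁ := 1) (N₂ := 6) (R := fun c' => _ = c') (det_arith rfl) ?_
  rintro _ rfl
  refine det_seq (N₁ := 1) (N₂ := 4) (R := fun c' => _ = c') (det_load rfl) ?_
  rintro _ rfl
  refine det_seq (N₁ := 1) (N₂ := 2) (R := fun c' => _ = c') (det_load rfl) ?_
  rintro _ rfl
  simp only [Config.assign, Op.eval, v8, v4, hsub, Function.update_self, a1j]
  refine det_ite (N := 1) (fun hb => ?_) (fun hb => ?_)
  · simp [Test.eval, v0, a2j, parentCode_eq_iff] at hb
    have := cutForest_succ_of_none hb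
    refine det_skip ⟨⟨?_, ?_, ?_, ?_, ?_, ?_, ?_, ?_⟩, ?_, ?_, ?_, ?_, hle', ?_, ?_⟩ <;> simp_all
  · simp [Test.eval, v0, a2j, parentCode_eq_iff] at hb
    obtain ⟨x, hx⟩ := Option.ne_none_iff_exists'.1 hb
    refine det_link t (b j) x (by simp [v7]) (by simp) (by simp [a2j, hx, parentCode])
      (by simp [hfs, cutForest_eq_none]) ?_ ?_
    · simp only [hfs]
      exact (T t).not_sameTree cutForest_subforest (cutForest_eq_none (by omega))
        (cutForest_subforest.apply_eq_some hx)
    · have := cutForest_of_succ hx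
      refine ⟨⟨?_, ?_, ?_, ?_, ?_, ?_, ?_, ?_⟩, ?_, ?_, ?_, ?_, hle', ?_, ?_⟩ <;>
        simp_all [Config.setForest]

/-- The sample is accepted for a tree: every vertex of depth `d` is hit. -/
def Accepts (T : OutTree (Fin n)) (d s : ℕ) (b : ℕ → Fin n) : Prop :=
  ∀ v ∈ T.verts, vertexDepth T.parent v = d → Hit T b s v

open Classical in
/-- The first `i` trees have been checked. -/
structure CheckState (T : Fin τ → OutTree (Fin n)) (d s : ℕ) (b : ℕ → Fin n) (i : ℕ)
    (c : Config n τ) : Prop where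
  frame : Frame T d s s b c
  var7 : c.var 7 = i
  var5 : c.var 5 = if ∀ t : Fin τ, t < i → Accepts (T t) d s b then 1 else 0
  forest : c.forest = fun i => (T i).parent

theorem CheckState.setTime {i : ℕ} (h : CheckState T d s b i c) (m : ℕ) :
    CheckState T d s b i { c with time := m } :=
  ⟨⟨h.1.1, h.1.2, h.1.3, h.1.4, h.1.5, h.1.6, h.1.7, h.1.8⟩, h.2, h.3, h.4⟩

theorem det_treeBody (h : CheckState T d s b t c) (hd : 1 ≤ d) (hT : (T t).DepthAtMost d)
    (hs : s < 2 ^ w) (hτ : τ < 2 ^ w) :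
    Det w q (20 * s + 14) treeBody c (CheckState T d s b (t + 1)) := by
  classical
  obtain ⟨⟨v0, v1, v2, v3, v4, v6, a0, a1⟩, v7, v5, hf⟩ := h
  have hadd : ((t : ℕ) + 1) % 2 ^ w = t + 1 := Nat.mod_eq_of_lt (by omega)
  generalize hg : (if ∀ t' : Fin τ, t' < (t : ℕ) → Accepts (T t') d s b then 1 else 0) = g at v5
  -- With the loop test, a cut costs 11 steps and its reversal 9, which gives 20 per sample.
  refine Det.mono (Q := CheckState T d s b (t + 1)) (N₁ := 1 + (1 + ((s * 11 + 1) +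
    (1 + (2 + ((s * 9 + 1) + 1 + 1) + 1) + 1) + 1) + 1) + 1) ?_ (by omega) fun _ h => h
  refine det_seq (R := fun c' => _ = c') (det_load rfl) ?_
  rintro _ rfl
  refine det_seq (R := CutState T d s b t g 0) (det_const ?_) fun c₁ h₁ => ?_
  · refine ⟨⟨?_, ?_, ?_, ?_, ?_, ?_, ?_, ?_⟩, ?_, ?_, ?_, ?_, Nat.zero_le _, ?_, ?_⟩ <;>
      simp_all [Config.assign, cutForest_zero]
  refine det_seq (R := CutState T d s b t g s) ?_ fun c₂ h₂ => ?_
  · refine det_loop (I := fun m c => m ≤ s ∧ CutState T d s b t g (s - m) c) ?_ ?_ s ?_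
    · rintro m c ⟨hm, h⟩
      refine ⟨by simp [Test.eval, h.var8, h.frame.var3]; omega, ?_⟩
      have := det_cutBody (w := w) (q := q) (c := { c with time := c.time + 1 })
        (h.setTime _)
        (by omega) hs
      refine this.mono le_rfl fun c' h' => ⟨by omega, ?_⟩
      rwa [show s - (m + 1) + 1 = s - m by omega] at h'
    · rintro c ⟨-, h⟩
      refine ⟨by simp [Test.eval, h.var8, h.frame.var3], ?_⟩
      exact (h.setTime _)
    · rw [Nat.sub_self]
      exact ⟨le_rfl, ⟨h₁.1.1, h₁.1.2, h₁.1.3, h₁.1.4, h₁.1.5, h₁.1.6, h₁.1.7, h₁.1.8⟩, h₁.2, h₁.3,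
        h₁.4, h₁.5, h₁.6, h₁.7, h₁.8⟩
  clear h₁ c₁
  have hfs := h₂.forest_self
  obtain ⟨⟨v0, v1, v2, v3, v4, v6, a0, a1⟩, v7, v11, v5, v8, hle, hf, a2⟩ := h₂
  refine det_seq (R := fun c' => _ = c') (det_depth t (T t).root (by simp [v7]) (by simp [v11]) rfl)
    ?_
  rintro _ rfl
  have hiff := (T t).treeDepth_cutForest_lt_iff (b := b) (j := s) hd hT
  simp only [hfs]
  set g' : ℕ := if ∀ t' : Fin τ, t' < (t : ℕ) + 1 → Accepts (T t') d s b then 1 else 0 with hg'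
  have hall : (∀ t' : Fin τ, t' < (t : ℕ) + 1 → Accepts (T t') d s b) ↔
      (∀ t' : Fin τ, t' < (t : ℕ) → Accepts (T t') d s b) ∧ Accepts (T t) d s b := by
    constructor
    · exact fun H => ⟨fun t' ht' => H t' (by omega), H t (by omega)⟩
    · rintro ⟨H, H'⟩ t' ht'
      rcases Nat.lt_succ_iff_lt_or_eq.1 ht' with h | h
      · exact H t' h
      · rwa [Fin.ext h]
  refine det_seq (R := CutState T d s b t g' s) ?_ fun c₃ h₃ => ?_
  · refine det_ite (fun hb => det_skip ?_) fun hb => det_copy ?_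
    · simp [Test.eval, Config.assign, v1] at hb
      have : g' = g := by
        rw [hg', ← hg]
        exact if_congr (hall.trans (and_iff_left (hiff.1 hb))) rfl rfl
      refine ⟨⟨?_, ?_, ?_, ?_, ?_, ?_, ?_, ?_⟩, ?_, ?_, ?_, ?_, le_rfl, ?_, ?_⟩ <;>
        simp_all [Config.assign]
    · simp [Test.eval, Config.assign, v1] at hb
      have : g' = 0 := by
        rw [hg']
        exact if_neg fun H => absurd (hiff.2 (hall.1 H).2) (by omega)
      clear hg hg' hall
      refine ⟨⟨?_, ?_, ?_, ?_, ?_, ?_, ?_, ?_⟩, ?_, ?_, ?_, ?_, le_rfl, ?_, ?_⟩ <;>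
        simp_all [Config.assign]
  clear v0 v1 v2 v3 v4 v6 a0 a1 v7 v11 v5 v8 hle hf a2
  refine det_seq (N₁ := s * 9 + 1) (N₂ := 1) (R := CutState T d s b t g' 0) ?_ fun c₄ h₄ => ?_
  · refine det_loop (I := fun m c => CutState T d s b t g' m c) ?_ ?_ s ?_
    · rintro m c h
      refine ⟨by simp [Test.eval, h.var8, h.frame.var6], ?_⟩
      exact det_linkBody (c := { c with time := c.time + 1 })
        (h.setTime _)
        hs
    · rintro c h
      refine ⟨by simp [Test.eval, h.var8, h.frame.var6], ?_⟩
      exact (h.setTime _)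
    · exact (h₃.setTime _)
  obtain ⟨⟨v0, v1, v2, v3, v4, v6, a0, a1⟩, v7, v11, v5, v8, hle, hf, a2⟩ := h₄
  refine det_arith ⟨⟨?_, ?_, ?_, ?_, ?_, ?_, ?_, ?_⟩, ?_, ?_, ?_⟩
  case refine_10 => simp [Config.assign, v5, hg']
  all_goals clear hg hg' hall
  all_goals simp_all [Config.assign, Op.eval, cutForest_zero]

open Classical in
/-- The outcome of the verification. -/
structure Verified (T : Fin τ → OutTree (Fin n)) (d s : ℕ) (b : ℕ → Fin n) (c : Config n τ) :
    Prop where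
  frame : Frame T d s s b c
  var5 : c.var 5 = if ∀ t, Accepts (T t) d s b then 1 else 0
  forest : c.forest = fun i => (T i).parent

theorem det_verify (h : Frame T d s s b c) (hf : c.forest = fun i => (T i).parent) (hd : 1 ≤ d)
    (hT : ∀ t, (T t).DepthAtMost d) (hs : s < 2 ^ w) (hτ : τ < 2 ^ w) (hw : 1 < 2 ^ w) :
    Det w q (τ * (20 * s + 15) + 5) verify c (Verified T d s b) := by
  classical
  obtain ⟨v0, v1, v2, v3, v4, v6, a0, a1⟩ := h
  have h1 : 1 % 2 ^ w = 1 := Nat.mod_eq_of_lt hw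
  refine Det.mono (Q := Verified T d s b)
    (N₁ := 1 + (1 + (τ * (20 * s + 14 + 1) + 1) + 1) + 1) ?_ (le_of_eq (by ring)) fun _ h => h
  refine det_seq (R := fun c' => _ = c') (det_const rfl) ?_
  rintro _ rfl
  refine det_seq (R := CheckState T d s b 0) (det_const ?_) fun c₁ h₁ => ?_
  · refine ⟨⟨?_, ?_, ?_, ?_, ?_, ?_, ?_, ?_⟩, ?_, ?_, ?_⟩ <;> simp_all [Config.assign]
  refine det_loop (I := fun m c => m ≤ τ ∧ CheckState T d s b (τ - m) c) ?_ ?_ τ ?_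
  · rintro m c ⟨hm, h⟩
    refine ⟨by simp [Test.eval, h.var7, h.frame.var2]; omega, ?_⟩
    have := det_treeBody (w := w) (q := q) (c := { c with time := c.time + 1 })
      (t := ⟨τ - (m + 1), by omega⟩)
      (h.setTime _) hd (hT _) hs hτ
    refine this.mono le_rfl fun c' h' => ⟨by omega, ?_⟩
    simp only [show τ - (m + 1) + 1 = τ - m by omega] at h'
    exact h'
  · rintro c ⟨-, h⟩
    refine ⟨by simp [Test.eval, h.var7, h.frame.var2], ?_⟩
    refine ⟨⟨h.1.1, h.1.2, h.1.3, h.1.4, h.1.5, h.1.6, h.1.7, h.1.8⟩, ?_, h.4⟩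
    exact h.3.trans (if_congr ⟨fun H t => H t t.2, fun H t _ => H t⟩ rfl rfl)
  · rw [Nat.sub_self]
    exact ⟨le_rfl, ⟨h₁.1.1, h₁.1.2, h₁.1.3, h₁.1.4, h₁.1.5, h₁.1.6, h₁.1.7, h₁.1.8⟩, h₁.2, h₁.3,
      h₁.4⟩

end Verify

/-! ### Failure probabilities -/

section Fail

variable {n τ : ℕ} {w q k N : ℕ} {c : Config n τ} {G Q : Config n τ → Prop} {x : ℝ≥0∞}

/-- The probability that the run has not halted after `k` steps in a configuration satisfying
`G`. -/
noncomputable def failProb (w q : ℕ) (G : Config n τ → Prop) (k : ℕ) (c : Config n τ) : ℝ≥0∞ :=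
  (run w q k c).toOuterMeasure {c' | ¬ (c'.Halted ∧ G c')}

theorem failProb_le_one : failProb w q G k c ≤ 1 := by
  unfold failProb
  rw [PMF.toOuterMeasure_apply]
  refine (ENNReal.tsum_le_tsum fun a => Set.indicator_le_self _ _ a).trans ?_
  rw [PMF.tsum_coe]

theorem run_of_halted (h : c.Halted) (k : ℕ) : run w q k c = PMF.pure c := by
  have hs : step w q c = PMF.pure c := by
    unfold step
    rw [show c.code = [] from h]
  induction k with
  | zero => rfl
  | succ k ih => rw [run, hs, PMF.pure_bind, ih]

theorem failProb_add (a k : ℕ) :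
    failProb w q G (a + k) c = ∑' c', run w q a c c' * failProb w q G k c' := by
  unfold failProb
  rw [run_add, PMF.toOuterMeasure_bind_apply]

theorem failProb_of_halted (h : c.Halted) (hG : G c) : failProb w q G k c = 0 := by
  unfold failProb
  rw [run_of_halted h, PMF.toOuterMeasure_pure_apply]
  exact if_neg fun h' => h' ⟨h, hG⟩

/-- Halted configurations never change, so success once reached is kept. This is what allows step
counts to be rounded up throughout. -/
theorem failProb_antitone {k' : ℕ} (hk : k ≤ k') : failProb w q G k' c ≤ failProb w q G k c := by
  classical
  obtain ⟨m, rfl⟩ := Nat.exists_eq_add_of_le hk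
  rw [failProb_add]
  conv_rhs => rw [failProb, PMF.toOuterMeasure_apply]
  refine ENNReal.tsum_le_tsum fun c' => ?_
  by_cases h : c'.Halted ∧ G c'
  · rw [failProb_of_halted h.1 h.2, mul_zero]; exact zero_le
  · rw [Set.indicator_of_mem (by exact h)]
    exact mul_le_of_le_one_right' failProb_le_one

theorem failProb_of_run {a : ℕ} {c' : Config n τ} (h : run w q a c = PMF.pure c') :
    failProb w q G (a + k) c = failProb w q G k c' := by
  unfold failProb
  rw [run_add, h, PMF.pure_bind]

theorem failProb_of_step {c' : Config n τ} (h : step w q c = PMF.pure c') :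
    failProb w q G (1 + k) c = failProb w q G k c' :=
  failProb_of_run (by rw [run_one, h])

theorem failProb_le_of_det {s : Stmt} {l : List Stmt} (h : Det w q N s c Q)
    (hQ : ∀ c', Q c' → failProb w q G k { c' with code := l } ≤ x) :
    failProb w q G (N + k) { c with code := s :: l } ≤ x := by
  obtain ⟨a, ha, c', hc', r⟩ := h
  refine (failProb_antitone (show a + k ≤ N + k by omega)).trans ?_
  rw [failProb_of_run (r l)]
  exact hQ c' hc'

theorem failProb_rand {y z : ℕ} {l : List Stmt} (hn : 0 < n) (hy : c.var y = n) :
    failProb w q G (1 + k) { c with code := Stmt.rand z y :: l } =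
      ∑ i : Fin n, (n : ℝ≥0∞)⁻¹ *
        failProb w q G k (Config.assign { c with code := l, time := c.time + 1 } z i) := by
  obtain ⟨m, rfl⟩ : ∃ m, n = m + 1 := ⟨n - 1, by omega⟩
  unfold failProb
  rw [run_add, run_one]
  have : step w q { c with code := Stmt.rand z y :: l } = (PMF.uniformOfFintype (Fin (m + 1))).map
      (fun i : Fin (m + 1) => Config.assign { c with code := l, time := c.time + 1 } z i) := by
    simp only [step, exec, hy]
    -- The draw is a distribution on numbers, the image of the uniform one on `Fin (m + 1)`;
    -- unfolding this leaves a single map.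
    change PMF.map _ (PMF.bind _ fun a : Fin (m + 1) => PMF.pure (a : ℕ)) = _
    rw [PMF.map_bind]
    simp only [PMF.pure_map]
    rfl
  rw [this, PMF.bind_map, PMF.toOuterMeasure_bind_apply, tsum_fintype]
  simp [PMF.uniformOfFintype_apply]

theorem time_le_of_mem_support {c' : Config n τ} (h : c' ∈ (run w q k c).support) :
    c'.time ≤ c.time + k * (1 + q) := by
  induction k generalizing c with
  | zero =>
    simp only [run, PMF.support_pure, Set.mem_singleton_iff] at h
    subst h; omega
  | succ k ih =>
    rw [run, PMF.mem_support_bind_iff] at h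
    obtain ⟨c₁, h₁, h₂⟩ := h
    have := ih h₂
    suffices c₁.time ≤ c.time + (1 + q) by rw [Nat.succ_mul]; omega
    clear ih this h₂
    unfold step at h₁
    split at h₁
    · simp only [PMF.support_pure, Set.mem_singleton_iff] at h₁
      subst h₁; omega
    · rename_i s rest _
      cases s <;> simp only [exec, PMF.support_pure, Set.mem_singleton_iff] at h₁
      case rand x y =>
        split at h₁
        · simp only [PMF.support_pure, Set.mem_singleton_iff] at h₁
          subst h₁; simp [Config.fail]
        · simp only [PMF.mem_support_map_iff] at h₁
          obtain ⟨_, -, rfl⟩ := h₁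
          simp [Config.assign]
      all_goals subst h₁
      case parent =>
        unfold Config.callParent
        split_ifs
        · split <;> simp [Config.assign] <;> omega
        · simp [Config.fail]; omega
      case link =>
        unfold Config.callLink
        split_ifs
        · dsimp only
          split_ifs <;> simp [Config.setForest, Config.fail] <;> omega
        · simp [Config.fail]; omega
      case cut =>
        unfold Config.callCut
        split_ifs
        · dsimp only
          split_ifs <;> simp [Config.setForest, Config.fail] <;> omega
        · simp [Config.fail]; omega
      case depth =>
        unfold Config.callDepth
        split_ifs <;> simp [Config.assign, Config.fail] <;> omega
      case loop => split_ifs <;> simp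
      all_goals simp [Config.assign, Config.write, Config.fail]

end Fail

/-! ### The sampling phase -/

/-- Draw a random vertex and store it as the sample with index `var 8`. -/
def sampleBody : Stmt :=
  .seq (.rand 9 0) <| .seq (.store 1 8 9) (.arith .add 8 8 4)

section Sample

variable {n τ : ℕ} {w q d s j k : ℕ} {T : Fin τ → OutTree (Fin n)} {b : ℕ → Fin n}
  {c : Config n τ} {G : Config n τ → Prop}

theorem hit_update_iff {V : Type} (T : OutTree V) (b : ℕ → V) (j : ℕ) (i v : V) :
    Hit T (Function.update b j i) (j + 1) v ↔
      Hit T b j v ∨ (i ≠ T.root ∧ IsAncestor T.parent i v) := by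
  constructor
  · rintro ⟨l, hl, h⟩
    rcases Nat.lt_succ_iff_lt_or_eq.1 hl with hlt | rfl
    · rw [Function.update_of_ne hlt.ne] at h
      exact Or.inl ⟨l, hlt, h⟩
    · rw [Function.update_self] at h
      exact Or.inr h
  · rintro (⟨l, hl, h⟩ | h)
    · refine ⟨l, by omega, ?_⟩
      rwa [Function.update_of_ne hl.ne]
    · refine ⟨j, by omega, ?_⟩
      rwa [Function.update_self]

open Classical in
/-- The pairs of a tree and a vertex of depth `d` that is not hit by the first `j` samples. -/
noncomputable def unhit (T : Fin τ → OutTree (Fin n)) (d : ℕ) (b : ℕ → Fin n) (j : ℕ) :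
    Finset (Fin τ × Fin n) :=
  Finset.univ.filter fun p =>
    (p.2 ∈ (T p.1).verts ∧ vertexDepth (T p.1).parent p.2 = d) ∧ ¬ Hit (T p.1) b j p.2

theorem one_le_card_unhit (h : ¬ ∀ t, Accepts (T t) d s b) : 1 ≤ (unhit T d b s).card := by
  simp only [Accepts, not_forall] at h
  obtain ⟨t, v, h1, h2, h3⟩ := h
  exact Finset.card_pos.2 ⟨(t, v), by simp [unhit, h1, h2, h3]⟩

theorem card_unhit_le : (unhit T d b j).card ≤ τ * n := by
  refine (Finset.card_le_univ _).trans ?_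
  simp

/-- Double counting: an unhit pair survives only those draws i that are not ancestors (other than
the root) of its vertex, and there are at most n - d of these. Divided by n, this says that one draw
multiplies the expected number of unhit pairs by at most `missProb n d`. -/
theorem sum_card_unhit_le (T : Fin τ → OutTree (Fin n)) (d : ℕ) (b : ℕ → Fin n) (j : ℕ) :
    ∑ i, (unhit T d (Function.update b j i) (j + 1)).card ≤ (unhit T d b j).card * (n - d) := by
  classical
  have h1 : ∀ i, unhit T d (Function.update b j i) (j + 1) = (unhit T d b j).filter
      fun p => ¬ (i ≠ (T p.1).root ∧ IsAncestor (T p.1).parent i p.2) := by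
    intro i
    ext p
    simp only [unhit, Finset.mem_filter, Finset.mem_univ, true_and, hit_update_iff, not_or]
    tauto
  simp only [h1]
  have h2 := Finset.sum_card_bipartiteAbove_eq_sum_card_bipartiteBelow
    (s := (Finset.univ : Finset (Fin n))) (t := unhit T d b j)
    (fun i p => ¬ (i ≠ (T p.1).root ∧ IsAncestor (T p.1).parent i p.2))
  simp only [Finset.bipartiteAbove, Finset.bipartiteBelow] at h2
  rw [h2]
  refine (Finset.sum_le_card_nsmul _ _ (n - d) fun p hp => ?_).trans (smul_eq_mul _ _).le
  simp only [unhit, Finset.mem_filter, Finset.mem_univ, true_and] at hp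
  have h3 := (T p.1).le_card_ancestors hp.1.1
  rw [hp.1.2] at h3
  have h4 := Finset.card_filter_add_card_filter_not (s := (Finset.univ : Finset (Fin n)))
    (fun i => i ≠ (T p.1).root ∧ IsAncestor (T p.1).parent i p.2)
  rw [Finset.card_univ, Fintype.card_fin] at h4
  exact (by omega : ∀ a x : ℕ, d ≤ a → a + x = n → x ≤ n - d) _ _
    (h3.trans_eq (by congr)) h4

/-- The probability that a random vertex avoids a given set of `d` vertices. -/
noncomputable def missProb (n d : ℕ) : ℝ≥0∞ := (n : ℝ≥0∞)⁻¹ * (n - d : ℕ)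

/-- The first `j` samples have been drawn. -/
structure SampleState (T : Fin τ → OutTree (Fin n)) (d s : ℕ) (b : ℕ → Fin n) (j : ℕ)
    (c : Config n τ) : Prop where
  frame : Frame T d s j b c
  var8 : c.var 8 = j
  le : j ≤ s
  forest : c.forest = fun i => (T i).parent

/-- Induction on the number m of draws left. The bound `H` is linear in the number of unhit pairs,
so averaging over each draw contributes one factor `missProb n d`; no independence argument is
needed. -/
theorem failProb_sample_le {l : List Stmt} {ε : ℝ≥0∞} (hn : 0 < n) (hs : s < 2 ^ w)
    (H : ∀ b c, SampleState T d s b s c →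
      failProb w q G k { c with code := l } ≤ (unhit T d b s).card * ε)
    (m : ℕ) (hm : m + j = s) (hc : SampleState T d s b j c) :
    failProb w q G (m * 6 + 1 + k) { c with code := Stmt.loop (.lt 8 3) sampleBody :: l } ≤
      (unhit T d b j).card * missProb n d ^ m * ε := by
  induction m generalizing j b c with
  | zero =>
    obtain ⟨⟨v0, v1, v2, v3, v4, v6, a0, a1⟩, v8, hle, hf⟩ := hc
    obtain rfl : j = s := by omega
    rw [show 0 * 6 + 1 + k = 1 + k by omega]
    rw [failProb_of_step (c' := { c with code := l, time := c.time + 1 })]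
    · rw [pow_zero, mul_one]
      exact H b { c with time := c.time + 1 } ⟨⟨v0, v1, v2, v3, v4, v6, a0, a1⟩, v8, hle, hf⟩
    · simp [step, exec, Test.eval, v3, v8]
  | succ m ih =>
    obtain ⟨⟨v0, v1, v2, v3, v4, v6, a0, a1⟩, v8, hle, hf⟩ := hc
    have hadd : (j + 1) % 2 ^ w = j + 1 := Nat.mod_eq_of_lt (by omega)
    -- Six steps per draw: the loop test, unfolding the body, the draw itself, and three steps to
    -- store and count.
    rw [show (m + 1) * 6 + 1 + k = 1 + (1 + (1 + (3 + (m * 6 + 1 + k)))) by ring]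
    rw [failProb_of_step (c' := { c with
        code := sampleBody :: Stmt.loop (.lt 8 3) sampleBody :: l, time := c.time + 1 })]
    swap
    · have : j < s := by omega
      simp [step, exec, Test.eval, v3, v8, this]
    rw [failProb_of_step (c' := { c with
        code := Stmt.rand 9 0 :: .seq (.store 1 8 9) (.arith .add 8 8 4) ::
          Stmt.loop (.lt 8 3) sampleBody :: l, time := c.time + 1 + 1 })]
    swap
    · simp [step, exec, sampleBody]
    rw [failProb_rand (c := { c with time := c.time + 1 + 1 }) hn v0]
    have key : ∀ i : Fin n, failProb w q G (3 + (m * 6 + 1 + k))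
        (Config.assign { c with code := (Stmt.seq (.store 1 8 9) (.arith .add 8 8 4)) ::
          (Stmt.loop (.lt 8 3) sampleBody) :: l, time := c.time + 1 + 1 + 1 } 9 i) ≤
        (unhit T d (Function.update b j i) (j + 1)).card * missProb n d ^ m * ε := by
      intro i
      refine failProb_le_of_det (c := Config.assign { c with time := c.time + 1 + 1 + 1 } 9 i)
        (Q := SampleState T d s (Function.update b j i) (j + 1)) ?_
        fun c' hc' => ih (by omega) hc'
      refine det_seq (N₁ := 1) (N₂ := 1) (R := fun c' => _ = c') (det_store rfl) ?_
      rintro _ rfl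
      have hup : ∀ l < j + 1, Function.update (c.arr 1) j (i : ℕ) l = Function.update b j i l := by
        intro l hl
        by_cases hlj : l = j
        · subst hlj; simp
        · rw [Function.update_of_ne hlj, Function.update_of_ne hlj]; exact a1 l (by omega)
      refine det_arith ⟨⟨?_, ?_, ?_, ?_, ?_, ?_, ?_, ?_⟩, ?_, ?_, ?_⟩
      case refine_8 => simpa [Config.assign, Config.write, v8] using hup
      case refine_10 => omega
      all_goals simp_all [Config.assign, Config.write, Op.eval]
    calc _ ≤ ∑ i : Fin n, (n : ℝ≥0∞)⁻¹ *
          ((unhit T d (Function.update b j i) (j + 1)).card * missProb n d ^ m * ε) :=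
          Finset.sum_le_sum fun i _ => mul_le_mul_right (key i) _
      _ = ((∑ i, (unhit T d (Function.update b j i) (j + 1)).card : ℕ) : ℝ≥0∞) *
          ((n : ℝ≥0∞)⁻¹ * missProb n d ^ m * ε) := by
          rw [Nat.cast_sum, Finset.sum_mul]
          exact Finset.sum_congr rfl fun i _ => by ring
      _ ≤ (((unhit T d b j).card * (n - d) : ℕ) : ℝ≥0∞) *
          ((n : ℝ≥0∞)⁻¹ * missProb n d ^ m * ε) := by
          gcongr
          exact sum_card_unhit_le T d b j
      _ = _ := by
          rw [Nat.cast_mul, pow_succ, missProb]; ring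

end Sample

/-! ### The program -/

/-- The number of samples. -/
def sampleSize (a n d : ℕ) : ℕ := a * (Nat.log 2 n + 1) * (n / d + 1)

/-- Halve `var 12` and count in `var 13`. -/
def logBody : Stmt := .seq (.arith .div 12 12 14) (.arith .add 13 13 4)

/-- Compute `sampleSize a n d` in `var 3`. -/
def setup (a : ℕ) : Stmt :=
  .seq (.const 4 1) <| .seq (.copy 12 0) <| .seq (.copy 13 4) <| .seq (.const 14 2) <|
    .seq (.loop (.lt 4 12) logBody) <| .seq (.const 3 a) <| .seq (.arith .mul 3 3 13) <|
    .seq (.arith .div 15 0 1) <| .seq (.arith .add 15 15 4) (.arith .mul 3 3 15)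

/-- Sample and verify. -/
def roundBody : Stmt :=
  .seq (.const 8 0) <| .seq (.loop (.lt 8 3) sampleBody) verify

/-- Sample and verify until the sample is accepted. -/
def program (a : ℕ) : Stmt :=
  .seq (setup a) (.loop (.eq 5 6) roundBody)

section Program

variable {n τ : ℕ} {w q d s a k : ℕ} {T : Fin τ → OutTree (Fin n)} {b : ℕ → Fin n}
  {c : Config n τ}

/-- The state before a round. -/
structure RoundState (T : Fin τ → OutTree (Fin n)) (d s : ℕ) (b : ℕ → Fin n) (c : Config n τ) :
    Prop where
  frame : Frame T d s 0 b c
  var5 : c.var 5 = 0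
  forest : c.forest = fun i => (T i).parent

/-- The output is an accepted sample of size `s`. -/
def Correct (T : Fin τ → OutTree (Fin n)) (d s : ℕ) (c : Config n τ) : Prop :=
  ∃ b : ℕ → Fin n, c.var 3 = s ∧ (∀ l < s, c.arr 1 l = b l) ∧ ∀ t, Accepts (T t) d s b

theorem Correct.exists_blockerSet (h : Correct T d s c) :
    ∃ B : Finset (Fin n), Enumerates c.output B ∧ IsBlockerSet T d B ∧ B.card ≤ s ∧
      c.output.length = s := by
  classical
  obtain ⟨b, h3, h1, hacc⟩ := h
  refine ⟨(Finset.range s).image b, ?_, ?_, ?_, ?_⟩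
  · ext x
    simp only [Config.output, h3, List.mem_toFinset, List.mem_map, List.mem_range, Finset.mem_map,
      Finset.mem_image, Finset.mem_range, Fin.valEmbedding_apply]
    constructor
    · rintro ⟨l, hl, rfl⟩
      exact ⟨b l, ⟨l, hl, rfl⟩, (h1 l hl).symm⟩
    · rintro ⟨_, ⟨l, hl, rfl⟩, rfl⟩
      exact ⟨l, hl, h1 l hl⟩
  · intro t v hv hd
    obtain ⟨l, hl, -, h⟩ := hacc t v hv hd
    exact ⟨b l, Finset.mem_image_of_mem b (Finset.mem_range.2 hl), h⟩
  · exact Finset.card_image_le.trans (Finset.card_range s).le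
  · simp [Config.output, h3]

/-- An upper bound for the number of steps of a round. -/
def roundSteps (τ s : ℕ) : ℕ := 6 * s + τ * (20 * s + 15) + 12

/-- After verification the failure probability is 0 if the sample is accepted and at most the bound
for r rounds otherwise. As rejection means at least one unhit pair, it is at most the number of
unhit pairs times that bound, the form needed by `failProb_sample_le`. -/
theorem failProb_rounds_le (hn : 0 < n) (hd : 1 ≤ d) (hT : ∀ t, (T t).DepthAtMost d)
    (hs : s < 2 ^ w) (hτ : τ < 2 ^ w) (hw : 1 < 2 ^ w) (r : ℕ) (hc : RoundState T d s b c) :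
    failProb w q (Correct T d s) (r * roundSteps τ s)
      { c with code := [Stmt.loop (.eq 5 6) roundBody] } ≤
        (((τ * n : ℕ) : ℝ≥0∞) * missProb n d ^ s) ^ r := by
  induction r generalizing b c with
  | zero => rw [pow_zero]; exact failProb_le_one
  | succ r ih =>
    obtain ⟨⟨v0, v1, v2, v3, v4, v6, a0, a1⟩, v5, hf⟩ := hc
    have hver : ∀ b c, SampleState T d s b s c →
        failProb w q (Correct T d s) (τ * (20 * s + 15) + 5 + (r * roundSteps τ s + 1))
          { c with code := [verify, Stmt.loop (.eq 5 6) roundBody] } ≤ (unhit T d b s).card *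
          (((τ * n : ℕ) : ℝ≥0∞) * missProb n d ^ s) ^ r := by
      intro b c h
      refine failProb_le_of_det (det_verify h.frame h.forest hd hT hs hτ hw) fun c' h' => ?_
      obtain ⟨⟨v0, v1, v2, v3, v4, v6, a0, a1⟩, v5, hf⟩ := h'
      by_cases hacc : ∀ t, Accepts (T t) d s b
      · rw [if_pos hacc] at v5
        rw [add_comm, failProb_of_step (c' := { c' with code := [], time := c'.time + 1 })]
        · refine (failProb_of_halted (c := { c' with code := [], time := c'.time + 1 }) rfl
            ?_).trans_le zero_le
          exact ⟨b, v3, a1, hacc⟩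
        · simp [step, exec, Test.eval, v5, v6]
      · rw [if_neg hacc] at v5
        refine (failProb_antitone (Nat.le_succ _)).trans ?_
        refine (ih ⟨⟨v0, v1, v2, v3, v4, v6, a0, fun l hl => a1 l (by omega)⟩, v5, hf⟩).trans ?_
        refine le_mul_of_one_le_left' ?_
        exact_mod_cast one_le_card_unhit hacc
    -- The inner `+ 1` pays for leaving the loop after acceptance; the outer one is slack.
    have hsteps : (r + 1) * roundSteps τ s =
        1 + (1 + (1 + (1 + (s * 6 + 1 + (τ * (20 * s + 15) + 5 + (r * roundSteps τ s + 1))))))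
          + 1 := by
      rw [Nat.succ_mul]
      nth_rewrite 2 [roundSteps]
      ring
    rw [hsteps]
    refine (failProb_antitone (Nat.le_succ _)).trans ?_
    rw [failProb_of_step (c' := { c with
      code := [roundBody, Stmt.loop (.eq 5 6) roundBody], time := c.time + 1 })]
    swap
    · simp [step, exec, Test.eval, v5, v6]
    rw [failProb_of_step (c' := { c with
      code := [Stmt.const 8 0, Stmt.seq (Stmt.loop (.lt 8 3) sampleBody) verify,
        Stmt.loop (.eq 5 6) roundBody], time := c.time + 1 + 1 })]
    swap
    · simp [step, exec, roundBody]
    rw [failProb_of_step (c' := Config.assign { c with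
      code := [Stmt.seq (Stmt.loop (.lt 8 3) sampleBody) verify,
        Stmt.loop (.eq 5 6) roundBody], time := c.time + 1 + 1 + 1 } 8 0)]
    swap
    · simp [step, exec]
    rw [failProb_of_step (c' := Config.assign { c with
      code := [Stmt.loop (.lt 8 3) sampleBody, verify, Stmt.loop (.eq 5 6) roundBody],
      time := c.time + 1 + 1 + 1 + 1 } 8 0)]
    swap
    · simp [step, exec, Config.assign]
    have := failProb_sample_le (b := b) (j := 0)
      (c := Config.assign { c with time := c.time + 1 + 1 + 1 + 1 } 8 0) hn hs hver s (by omega)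
      (by
        refine ⟨⟨?_, ?_, ?_, ?_, ?_, ?_, ?_, ?_⟩, ?_, ?_, ?_⟩ <;> simp_all [Config.assign])
    refine this.trans ?_
    rw [pow_succ, mul_comm (_ ^ r)]
    gcongr
    exact card_unhit_le

/-- Ensures that the computation of the sample size does not overflow, and fixes the word length
exponent a + 3. -/
theorem sampleSize_lt (hn : 2 ≤ n) : sampleSize a n d < n ^ (a + 3) := by
  have h1 : Nat.log 2 n + 1 ≤ n := Nat.log_lt_self 2 (by omega)
  have h2 : n / d ≤ n := Nat.div_le_self n d
  have h3 : n / d + 1 ≤ n * n := by nlinarith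
  have h4 : a < n ^ a := Nat.lt_pow_self (by omega)
  calc sampleSize a n d ≤ a * n * (n * n) := Nat.mul_le_mul (Nat.mul_le_mul_left a h1) h3
    _ = a * n ^ 3 := by ring
    _ < n ^ a * n ^ 3 := Nat.mul_lt_mul_of_pos_right h4 (by positivity)
    _ = n ^ (a + 3) := by ring

theorem det_setup (hn : 2 ≤ n) (ha : 1 ≤ a) (hw : n ^ (a + 3) ≤ 2 ^ w)
    (b : ℕ → Fin n) (P : Stmt) (m : ℕ) :
    Det w q (4 * Nat.log 2 n + 20) (setup a) { (initial P d T : Config n τ) with time := m }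
      (RoundState T d (sampleSize a n d) b) := by
  have hS : sampleSize a n d < 2 ^ w := (sampleSize_lt hn).trans_le hw
  have hsz : a * (Nat.log 2 n + 1) ≤ sampleSize a n d := Nat.le_mul_of_pos_right _ (Nat.succ_pos _)
  have hsz₁ : Nat.log 2 n + 1 ≤ a * (Nat.log 2 n + 1) := Nat.le_mul_of_pos_left _ ha
  have hsz₂ : a ≤ a * (Nat.log 2 n + 1) := Nat.le_mul_of_pos_right _ (by omega)
  have hsz₃ : n / d + 1 ≤ sampleSize a n d := Nat.le_mul_of_pos_left _ (by positivity)
  have h8 : n ^ 2 ≤ 2 ^ w := (Nat.pow_le_pow_right (by omega) (by omega)).trans hw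
  have hn2 : n < 2 ^ w := by nlinarith
  have h2 : 2 < 2 ^ w := by omega
  have e1 : 1 % 2 ^ w = 1 := Nat.mod_eq_of_lt (by omega)
  have e2 : 2 % 2 ^ w = 2 := Nat.mod_eq_of_lt h2
  have e3 : a % 2 ^ w = a := Nat.mod_eq_of_lt (by omega)
  have e4 : (a * (Nat.log 2 n + 1)) % 2 ^ w = a * (Nat.log 2 n + 1) := Nat.mod_eq_of_lt (by omega)
  have e5 : (n / d) % 2 ^ w = n / d := Nat.mod_eq_of_lt (by omega)
  have e6 : (n / d + 1) % 2 ^ w = n / d + 1 := Nat.mod_eq_of_lt (by omega)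
  have e7 : (a * (Nat.log 2 n + 1) * (n / d + 1)) % 2 ^ w = a * (Nat.log 2 n + 1) * (n / d + 1) :=
    Nat.mod_eq_of_lt hS
  set L := Nat.log 2 n with hL
  -- Variable 12 is halved from n down to 1, with m halvings left; variable 13 starts at 1 and so
  -- ends at log₂ n + 1.
  let J : ℕ → Config n τ → Prop := fun m c =>
    c.var 0 = n ∧ c.var 1 = d ∧ c.var 2 = τ ∧ c.var 4 = 1 ∧ c.var 5 = 0 ∧ c.var 6 = 0 ∧
      c.var 14 = 2 ∧ c.var 13 + m = L + 1 ∧ Nat.log 2 (c.var 12) = m ∧ 1 ≤ c.var 12 ∧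
      c.var 12 ≤ n ∧ (∀ i : Fin τ, c.arr 0 i = (T i).root) ∧ c.forest = fun i => (T i).parent
  refine Det.mono (Q := RoundState T d (sampleSize a n d) b) (N₁ := 1 + (1 + (1 + (1 +
    ((L * (3 + 1) + 1) + 9 + 1) + 1) + 1) + 1) + 1) ?_ (by omega) fun _ h => h
  refine det_seq (N₁ := 1) (R := fun c' => _ = c') (det_const rfl) ?_
  rintro _ rfl
  refine det_seq (N₁ := 1) (R := fun c' => _ = c') (det_copy rfl) ?_
  rintro _ rfl
  refine det_seq (N₁ := 1) (R := fun c' => _ = c') (det_copy rfl) ?_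
  rintro _ rfl
  refine det_seq (N₁ := 1) (R := J L) (det_const ?_) ?_
  · refine ⟨?_, ?_, ?_, ?_, ?_, ?_, ?_, ?_, ?_, ?_, ?_, ?_, ?_⟩ <;>
      simp [Config.assign, initial, e1, e2, hL] <;> omega
  intro c₁ h₁
  refine det_seq (N₁ := L * (3 + 1) + 1)
    (N₂ := 9) (R := J 0) ?_ ?_
  · refine det_loop (I := J) ?_ ?_ L h₁
    · rintro m c ⟨v0, v1, v2, v4, v5, v6, v14, v13, v12, hpos, hle, a0, hf⟩
      have hlt : 1 < c.var 12 := by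
        by_contra! h
        rw [Nat.log_of_lt (by omega)] at v12; omega
      refine ⟨by simp [Test.eval, v4, hlt], ?_⟩
      have hdiv : (c.var 12 / 2) % 2 ^ w = c.var 12 / 2 := Nat.mod_eq_of_lt (by omega)
      have hadd : (c.var 13 + 1) % 2 ^ w = c.var 13 + 1 := Nat.mod_eq_of_lt (by omega)
      refine det_seq (N₁ := 1) (N₂ := 1) (R := fun c' => _ = c') (det_arith rfl) ?_
      rintro _ rfl
      refine det_arith ⟨?_, ?_, ?_, ?_, ?_, ?_, ?_, ?_, ?_, ?_, ?_, ?_, ?_⟩ <;>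
        simp [Config.assign, Op.eval, v0, v1, v2, v4, v5, v6, v14, hdiv, hadd, a0, hf,
          Nat.log_div_base, v12] <;> omega
    · rintro c h
      obtain ⟨v0, v1, v2, v4, v5, v6, v14, v13, v12, hpos, hle, a0, hf⟩ := h
      refine ⟨?_, ⟨v0, v1, v2, v4, v5, v6, v14, v13, v12, hpos, hle, a0, hf⟩⟩
      rcases Nat.log_eq_zero_iff.1 v12 with h | h
      · simp [Test.eval, v4]; omega
      · omega
  rintro c₂ ⟨v0, v1, v2, v4, v5, v6, -, v13, -, -, -, a0, hf⟩
  rw [add_zero] at v13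
  refine det_seq (N₁ := 1) (N₂ := 7) (R := fun c' => _ = c') (det_const rfl) ?_
  rintro _ rfl
  refine det_seq (N₁ := 1) (N₂ := 5) (R := fun c' => _ = c') (det_arith rfl) ?_
  rintro _ rfl
  refine det_seq (N₁ := 1) (N₂ := 3) (R := fun c' => _ = c') (det_arith rfl) ?_
  rintro _ rfl
  refine det_seq (N₁ := 1) (N₂ := 1) (R := fun c' => _ = c') (det_arith rfl) ?_
  rintro _ rfl
  refine det_arith ⟨⟨?_, ?_, ?_, ?_, ?_, ?_, ?_, ?_⟩, ?_, ?_⟩ <;>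
    simp [Config.assign, Op.eval, sampleSize, ← hL, v0, v1, v2, v4, v5, v6, v13, a0, hf, e3, e4,
      e5, e6, e7]

/-- A sample of `sampleSize (A + α + 2) n d` vertices is rejected with probability at most
`1 / n`. -/
theorem missProb_pow_le {A α : ℕ} (hn : 2 ≤ n) (hd : 1 ≤ d) (hdn : d ≤ n) (hτ : τ ≤ A * n ^ α) :
    ((τ * n : ℕ) : ℝ≥0∞) * missProb n d ^ sampleSize (A + α + 2) n d ≤ (n : ℝ≥0∞)⁻¹ := by
  have hn0 : (n : ℝ≥0∞) ≠ 0 := by simp; omega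
  have hnt : (n : ℝ≥0∞) ≠ ⊤ := ENNReal.natCast_ne_top n
  -- Since (n / d + 1) d ≥ n, the power is at most exp(-1) ≤ 1/2. The further factors of the sample
  -- size raise this to 1/n and then to n^(-(A + α + 2)).
  have hhalf : missProb n d ^ (n / d + 1) ≤ 2⁻¹ := by
    have hnR : (0 : ℝ) < n := by positivity
    have hdR : (0 : ℝ) < d := by positivity
    have h1 : missProb n d = ENNReal.ofReal (1 - d / n) := by
      rw [missProb, show (1 : ℝ) - d / n = (n : ℝ)⁻¹ * (n - d : ℕ) by
        rw [Nat.cast_sub hdn]; field_simp, ENNReal.ofReal_mul (by positivity),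
        ENNReal.ofReal_inv_of_pos hnR, ENNReal.ofReal_natCast, ENNReal.ofReal_natCast]
    have h0 : (0 : ℝ) ≤ 1 - d / n := by
      rw [sub_nonneg, div_le_one hnR]; exact_mod_cast hdn
    rw [h1, ← ENNReal.ofReal_pow h0, ← ENNReal.ofReal_ofNat,
      ← ENNReal.ofReal_inv_of_pos (by norm_num)]
    apply ENNReal.ofReal_le_ofReal
    have h2 : (1 : ℝ) - d / n ≤ Real.exp (-(d / n)) := by
      have := Real.add_one_le_exp (-(d / n : ℝ)); linarith
    calc (1 - (d : ℝ) / n) ^ (n / d + 1) ≤ Real.exp (-(d / n)) ^ (n / d + 1) :=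
          pow_le_pow_left₀ h0 h2 _
      _ = Real.exp (-(((n / d + 1 : ℕ) : ℝ) * (d / n))) := by rw [← Real.exp_nat_mul]; ring_nf
      _ ≤ Real.exp (-1) := by
          apply Real.exp_le_exp.2
          rw [neg_le_neg_iff, mul_div_assoc', le_div_iff₀ hnR, one_mul]
          have : n ≤ (n / d + 1) * d := (Nat.lt_div_mul_add hd).le.trans_eq (by ring)
          exact_mod_cast this
      _ ≤ 2⁻¹ := by
          rw [Real.exp_neg]
          apply inv_anti₀ (by norm_num)
          have := Real.add_one_le_exp (1 : ℝ); linarith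
  have hlog : (2⁻¹ : ℝ≥0∞) ^ (Nat.log 2 n + 1) ≤ (n : ℝ≥0∞)⁻¹ := by
    rw [← ENNReal.inv_pow, ENNReal.inv_le_inv]
    exact_mod_cast (Nat.lt_pow_succ_log_self (by norm_num) n).le
  have hpow : missProb n d ^ sampleSize (A + α + 2) n d ≤ ((n : ℝ≥0∞)⁻¹) ^ (A + α + 2) := by
    rw [sampleSize, mul_comm, pow_mul, mul_comm, pow_mul]
    gcongr
    exact (pow_le_pow_left' hhalf _).trans hlog
  -- The constant A is absorbed by A ≤ n^A.
  have hτ' : τ * n ≤ n ^ (A + α + 1) := by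
    have : A ≤ n ^ A := (Nat.lt_pow_self (by omega)).le
    calc τ * n ≤ (n ^ A * n ^ α) * n := by gcongr; exact hτ.trans (by gcongr)
      _ = _ := by ring
  calc ((τ * n : ℕ) : ℝ≥0∞) * missProb n d ^ sampleSize (A + α + 2) n d
      ≤ ((n ^ (A + α + 1) : ℕ) : ℝ≥0∞) * ((n : ℝ≥0∞)⁻¹) ^ (A + α + 2) := by gcongr
    _ = ((n : ℝ≥0∞) * (n : ℝ≥0∞)⁻¹) ^ (A + α + 1) * (n : ℝ≥0∞)⁻¹ := by
        rw [Nat.cast_pow, pow_succ _ (A + α + 1), mul_pow, mul_assoc]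
    _ = _ := by rw [ENNReal.mul_inv_cancel hn0 hnt, one_pow, one_mul]

end Program

/-! ### Step counts, correctness, almost sure halting and the time bound -/

section Main

variable {n τ : ℕ} {w q d a k A α : ℕ} {T : Fin τ → OutTree (Fin n)}

/-- The number of steps of the program within which `r` rounds are finished. -/
def totalSteps (n τ s r : ℕ) : ℕ := 1 + (4 * Nat.log 2 n + 20 + r * roundSteps τ s)

theorem failProb_program_le (h : IsInput A α (A + α + 2 + 3) n d τ w T) (r : ℕ) :
    failProb w q (Correct T d (sampleSize (A + α + 2) n d))
      (totalSteps n τ (sampleSize (A + α + 2) n d) r) (initial (program (A + α + 2)) d T) ≤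
        (n : ℝ≥0∞)⁻¹ ^ r := by
  have hn := h.two_le
  have hS := (sampleSize_lt (a := A + α + 2) (d := d) hn).trans_le h.word
  have hw : 1 < 2 ^ w := (Nat.one_lt_pow (by omega) (by omega)).trans_le h.word
  have hτ : τ < 2 ^ w := by
    refine lt_of_lt_of_le ?_ h.word
    calc τ ≤ A * n ^ α := h.card_le
      _ < n ^ A * n ^ α := Nat.mul_lt_mul_of_pos_right (Nat.lt_pow_self (by omega)) (by positivity)
      _ = n ^ (A + α) := (pow_add _ _ _).symm
      _ ≤ n ^ (A + α + 2 + 3) := Nat.pow_le_pow_right (by omega) (by omega)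
  rw [totalSteps, failProb_of_step (c' := { (initial (program (A + α + 2)) d T : Config n τ) with
    code := [setup (A + α + 2), Stmt.loop (.eq 5 6) roundBody], time := 1 })]
  swap
  · simp [step, exec, initial, program]
  refine failProb_le_of_det (c := { (initial (program (A + α + 2)) d T : Config n τ) with
    time := 1 }) (det_setup hn (by omega) h.word (fun _ => ⟨0, by omega⟩) _ 1) fun c' hc' => ?_
  refine (failProb_rounds_le (by omega) h.d_pos h.depth hS hτ hw r hc').trans ?_
  gcongr
  exact missProb_pow_le hn h.d_pos h.d_le h.card_le

theorem log_bounds (hn : 2 ≤ n) :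
    (1 : ℝ) ≤ 2 * Real.log n ∧ ((Nat.log 2 n + 1 : ℕ) : ℝ) ≤ 4 * Real.log n := by
  have h2 := Real.log_two_gt_d9
  have hn2 : Real.log 2 ≤ Real.log n := Real.log_le_log (by norm_num) (by exact_mod_cast hn)
  have h3 : (Nat.log 2 n : ℝ) * Real.log 2 ≤ Real.log n := by
    rw [← Real.log_pow]
    refine Real.log_le_log (by positivity) ?_
    exact_mod_cast Nat.pow_log_le_self 2 (by omega)
  refine ⟨by linarith, ?_⟩
  push_cast
  nlinarith [(Nat.cast_nonneg (Nat.log 2 n) : (0 : ℝ) ≤ _)]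

theorem sampleSize_le (hn : 2 ≤ n) (hd : 1 ≤ d) (hdn : d ≤ n) :
    (sampleSize a n d : ℝ) ≤ 8 * a * ((n : ℝ) / d * Real.log n) := by
  have hd' : (0 : ℝ) < d := by positivity
  have h1 : (1 : ℝ) ≤ (n : ℝ) / d := by
    rw [one_le_div hd']; exact_mod_cast hdn
  have h2 : ((n / d + 1 : ℕ) : ℝ) ≤ 2 * ((n : ℝ) / d) := by
    push_cast
    have : ((n / d : ℕ) : ℝ) ≤ (n : ℝ) / d := Nat.cast_div_le
    linarith
  have h3 := (log_bounds hn).2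
  calc (sampleSize a n d : ℝ)
      = a * (((Nat.log 2 n + 1 : ℕ) : ℝ) * ((n / d + 1 : ℕ) : ℝ)) := by
        rw [sampleSize, Nat.cast_mul, Nat.cast_mul, mul_assoc]
    _ ≤ a * ((4 * Real.log n) * (2 * ((n : ℝ) / d))) := by gcongr
    _ = _ := by ring

/-- Every term is at most a multiple of τ s, because s ≥ log₂ n + 1 and τ ≥ 1; the constants are 25
= 4 + 21 and 53 = 6 + 20 + 15 + 12. -/
theorem totalSteps_le (hτ : 1 ≤ τ) (ha : 1 ≤ a) (r : ℕ) :
    totalSteps n τ (sampleSize a n d) r ≤ (25 + 53 * r) * (τ * sampleSize a n d) := by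
  have h1 : Nat.log 2 n + 1 ≤ sampleSize a n d := by
    refine (Nat.le_mul_of_pos_left _ ha).trans (Nat.le_mul_of_pos_right _ (Nat.succ_pos _))
  generalize sampleSize a n d = s at *
  have h2 : s ≤ τ * s := Nat.le_mul_of_pos_left _ hτ
  have h3 : τ ≤ τ * s := Nat.le_mul_of_pos_right _ (by omega)
  have h4 : roundSteps τ s ≤ 53 * (τ * s) := by
    rw [roundSteps, show τ * (20 * s + 15) = 20 * (τ * s) + 15 * τ by ring]
    omega
  calc totalSteps n τ s r ≤ 25 * (τ * s) + r * (53 * (τ * s)) := by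
        have := Nat.mul_le_mul_left r h4
        unfold totalSteps
        omega
    _ = _ := by ring

theorem one_sub_failProb_le {w q k : ℕ} {G : Config n τ → Prop} {c : Config n τ}
    {S : Set (Config n τ)} (h : ∀ c', c'.Halted ∧ G c' → c' ∈ S) :
    1 - failProb w q G k c ≤ (run w q k c).toOuterMeasure S := by
  have h1 : (run w q k c).toOuterMeasure Set.univ = 1 := by
    rw [PMF.toOuterMeasure_apply_eq_one_iff]; exact Set.subset_univ _
  rw [tsub_le_iff_right, ← h1]
  refine (MeasureTheory.measure_mono ?_).trans (MeasureTheory.measure_union_le S _)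
  intro c' _
  by_cases hc : c'.Halted ∧ G c'
  · exact Or.inl (h c' hc)
  · exact Or.inr hc

theorem tendsto_inv_pow (hn : 2 ≤ n) :
    Filter.Tendsto (fun r : ℕ => (n : ℝ≥0∞)⁻¹ ^ r) Filter.atTop (nhds 0) := by
  apply ENNReal.tendsto_pow_atTop_nhds_zero_of_lt_one
  rw [ENNReal.inv_lt_one]
  exact_mod_cast hn

/-- A reachable halted configuration with a wrong output would keep its probability mass forever and
count as a failure after any number of rounds. Since the failure probability tends to 0, that mass
is 0. -/
theorem correct_of_mem_support (h : IsInput A α (A + α + 2 + 3) n d τ w T) {c : Config n τ}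
    (hc : c ∈ (run w q k (initial (program (A + α + 2)) d T)).support) (hh : c.Halted) :
    Correct T d (sampleSize (A + α + 2) n d) c := by
  by_contra hG
  have hle : ∀ r : ℕ, run w q k (initial (program (A + α + 2)) d T) c ≤ (n : ℝ≥0∞)⁻¹ ^ r := by
    intro r
    refine le_trans ?_ (failProb_program_le (q := q) h r)
    refine le_trans ?_ (failProb_antitone
      (show totalSteps n τ (sampleSize (A + α + 2) n d) r ≤ k + _ from Nat.le_add_left _ k))
    rw [failProb_add]
    refine le_trans ?_ (ENNReal.le_tsum c)
    have hmem : c ∈ {c' : Config n τ |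
        ¬ (c'.Halted ∧ Correct T d (sampleSize (A + α + 2) n d) c')} := fun h' => hG h'.2
    rw [failProb, run_of_halted hh, PMF.toOuterMeasure_pure_apply, if_pos hmem, mul_one]
  exact (PMF.mem_support_iff _ _).1 hc
    (le_antisymm (ge_of_tendsto' (tendsto_inv_pow h.two_le) hle) zero_le)

theorem haltProb_program (h : IsInput A α (A + α + 2 + 3) n d τ w T) :
    haltProb w q (program (A + α + 2)) d T = 1 := by
  apply le_antisymm
  · refine iSup_le fun k => ?_
    rw [PMF.toOuterMeasure_apply]
    exact (ENNReal.tsum_le_tsum fun a => Set.indicator_le_self _ _ a).trans (PMF.tsum_coe _).le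
  · have hle : ∀ r : ℕ, 1 - (n : ℝ≥0∞)⁻¹ ^ r ≤ haltProb w q (program (A + α + 2)) d T := by
      intro r
      refine (tsub_le_tsub_left (failProb_program_le (q := q) h r) 1).trans ?_
      exact (one_sub_failProb_le fun _ hc' => hc'.1).trans
        (le_iSup (fun k => (run w q k (initial (program (A + α + 2)) d T)).toOuterMeasure
          {c | c.Halted}) _)
    have := ENNReal.Tendsto.sub (tendsto_const_nhds (x := (1 : ℝ≥0∞))) (tendsto_inv_pow h.two_le)
      (Or.inl ENNReal.one_ne_top)
    rw [tsub_zero] at this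
    exact le_of_tendsto' this hle

theorem le_haltProbWithin_program (h : IsInput A α (A + α + 2 + 3) n d τ w T) (r : ℕ) {t : ℝ}
    (ht : ((totalSteps n τ (sampleSize (A + α + 2) n d) r : ℕ) : ℝ) * (1 + q) ≤ t) :
    1 - (n : ℝ≥0∞)⁻¹ ^ r ≤ haltProbWithin w q (program (A + α + 2)) d T t := by
  set N := totalSteps n τ (sampleSize (A + α + 2) n d) r with hN
  have hNt : N ≤ ⌊t⌋₊ := by
    apply Nat.le_floor
    refine le_trans ?_ ht
    have : (0 : ℝ) ≤ N * q := by positivity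
    linarith
  have hle : failProb w q
      (fun c => Correct T d (sampleSize (A + α + 2) n d) c ∧ (c.time : ℝ) ≤ t) ⌊t⌋₊
      (initial (program (A + α + 2)) d T) ≤ (n : ℝ≥0∞)⁻¹ ^ r := by
    -- After N steps the clock shows at most N (1 + q) ≤ t, and it stands still once the run has
    -- halted.
    refine (failProb_antitone hNt).trans (le_trans ?_ (failProb_program_le (q := q) h r))
    refine PMF.toOuterMeasure_mono _ ?_
    rintro c' ⟨h1, h2⟩ ⟨h3, h4⟩
    refine h1 ⟨h3, h4, le_trans ?_ ht⟩
    have := time_le_of_mem_support h2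
    rw [show (initial (program (A + α + 2)) d T : Config n τ).time = 0 from rfl, zero_add] at this
    exact_mod_cast this
  exact (tsub_le_tsub_left hle 1).trans
    (one_sub_failProb_le fun c' hc' => ⟨hc'.1, hc'.2.2⟩)

theorem inv_pow_le_rpow (hn : 2 ≤ n) (β : ℝ) :
    (n : ℝ≥0∞)⁻¹ ^ ⌈β⌉₊ ≤ ENNReal.ofReal ((n : ℝ) ^ (-β)) := by
  have hn' : (0 : ℝ) < n := by positivity
  rw [← ENNReal.ofReal_natCast, ← ENNReal.ofReal_inv_of_pos hn',
    ← ENNReal.ofReal_pow (by positivity)]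
  apply ENNReal.ofReal_le_ofReal
  rw [← Real.rpow_natCast, Real.inv_rpow hn'.le, ← Real.rpow_neg hn'.le]
  apply Real.rpow_le_rpow_of_exponent_le
  · exact_mod_cast (by omega : 1 ≤ n)
  · linarith [Nat.le_ceil β]

end Main

end DynTreeRAM
open DynTreeRAM in
theorem mainTheorem10 (A α : ℕ) :
    ∃ (P : Stmt) (κ : ℕ) (C₀ : ℝ),
      -- whenever the program halts, its output is a small blocker set; it halts almost surely
      (∀ (n d τ w q : ℕ) (T : Fin τ → OutTree (Fin n)), IsInput A α κ n d τ w T →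
        (∀ k, ∀ c ∈ (run w q k (initial P d T)).support, c.Halted →
          ∃ B : Finset (Fin n), Enumerates c.output B ∧ IsBlockerSet T d B ∧
            (B.card : ℝ) ≤ C₀ * ((n : ℝ) / d * Real.log n) ∧
            (c.output.length : ℝ) ≤ C₀ * ((n : ℝ) / d * Real.log n)) ∧
        haltProb w q P d T = 1) ∧
      -- running time with high probability, if dynamic tree operations take time `O(log n)`
      (∀ K β : ℝ, ∃ C : ℝ, ∀ (n d τ w q : ℕ) (T : Fin τ → OutTree (Fin n)),
        IsInput A α κ n d τ w T → (q : ℝ) ≤ K * Real.log n →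
          1 - ENNReal.ofReal ((n : ℝ) ^ (-β)) ≤
            haltProbWithin w q P d T (C * (τ * ((n : ℝ) / d) * Real.log n ^ 2))) := by
  refine ⟨program (A + α + 2), A + α + 2 + 3, 8 * (A + α + 2 : ℕ), ?_, ?_⟩
  · intro n d τ w q T h
    refine ⟨fun k c hc hh => ?_, haltProb_program h⟩
    obtain ⟨B, h1, h2, h3, h4⟩ := (correct_of_mem_support h hc hh).exists_blockerSet
    have hs := sampleSize_le (a := A + α + 2) h.two_le h.d_pos h.d_le
    refine ⟨B, h1, h2, le_trans (by exact_mod_cast h3) hs, ?_⟩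
    rw [h4]
    exact hs
  · intro K β
    -- The factors come from the steps of ⌈β⌉ rounds, from the sample size, and from the cost 1 + q
    -- ≤ (2 + K) log n of a step, where 1 ≤ 2 log n.
    refine ⟨(25 + 53 * ⌈β⌉₊ : ℕ) * (8 * (A + α + 2 : ℕ)) * (2 + K), fun n d τ w q T h hq => ?_⟩
    refine (tsub_le_tsub_left (inv_pow_le_rpow h.two_le β) 1).trans
      (le_haltProbWithin_program h _ ?_)
    have hs := sampleSize_le (a := A + α + 2) h.two_le h.d_pos h.d_le
    have hsteps : ((totalSteps n τ (sampleSize (A + α + 2) n d) ⌈β⌉₊ : ℕ) : ℝ) ≤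
        (25 + 53 * ⌈β⌉₊ : ℕ) * (τ * (8 * (A + α + 2 : ℕ) * ((n : ℝ) / d * Real.log n))) := by
      calc ((totalSteps n τ (sampleSize (A + α + 2) n d) ⌈β⌉₊ : ℕ) : ℝ)
          ≤ (((25 + 53 * ⌈β⌉₊) * (τ * sampleSize (A + α + 2) n d) : ℕ) : ℝ) :=
            Nat.cast_le.2 (totalSteps_le h.nonempty (by omega) _)
        _ = (25 + 53 * ⌈β⌉₊ : ℕ) * (τ * (sampleSize (A + α + 2) n d : ℝ)) := by
            rw [Nat.cast_mul, Nat.cast_mul]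
        _ ≤ _ := by gcongr
    have hlog := (log_bounds h.two_le).1
    have hq' : (1 + q : ℝ) ≤ (2 + K) * Real.log n := by linarith
    calc _ ≤ _ := mul_le_mul hsteps hq' (by positivity) (le_trans (by positivity) hsteps)
      _ = _ := by ring
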